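/- Let $V$ be a Euclidean space of finite dimension $d>1$ and let $C\subset V$ be a closed convex cone with $C\cap(-C)=\{0\}$ and nonempty interior $C^0$. Let $S$ be the semigroup of endomorphisms $a$ of $V$ with $aC\subset C$, and let $S^0=\{a\in S: a(C\setminus\{0\})\subset C^0\}$. Let $\mu$ be a probability measure carried by $S$, let $A,A_1,A_2,\dots$ be independent with law $\mu$, and assume $\mathbb E|A|<\infty$ ($|\cdot|$ is the operator norm). Assume that the smallest closed subsemigroup $[\operatorname{supp}\mu]$ containing the support of $\mu$ satisfies condition $(\mathcal C)$: no linear subspace $W\subsetneq V$ with $W\cap C\neq\{0\}$ satisfies $[\operatorname{supp}\mu]\,W\subset W$, and $[\operatorname{supp}\mu]\cap S^0\neq\emptyset$. Let $N$ be an integer-valued random variable with $N\ge 2$ a.s. and $\mathbb E[N^2]<\infty$. Let $I_\mu=\{s\ge 0:\mathbb E|A|^s<\infty\}$ and, for $s\in I_\mu$, let $\kappa(s)=\lim_{n\to\infty}\mathbb E\big[|A_n\cdots A_1|^s\big]^{1/n}$. Let $Z$ be a fixed point of the smoothing transform: a $C$-valued random vector with $\mathbb E|Z|<\infty$ and $\mathbb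 E Z\neq 0$ that has the same law as $\sum_{i=1}^N A_iZ_i$, where the $Z_i$ are copies of $Z$ and $N$, $(A_i)_i$, $(Z_i)_i$ are all independent. Then for every real $h>1$, $$\mathbb E|Z|^h<\infty\quad\Longleftrightarrow\quad h\in I_\mu,\ \ \kappa(h)<\frac1{\mathbb E[N]}\ \text{ and }\ \mathbb E[N^h]<\infty .$$ In particular, whenever $\mathbb E[N^h]<\infty$ (which is automatic if $h\le 2$ or $N$ is bounded), $\mathbb E|Z|^h<\infty$ holds if and only if $h\in I_\mu$ and $\kappa(h)<1/\mathbb E[N]$. -/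

import Mathlib

open MeasureTheory Filter
open scoped ENNReal

noncomputable section

namespace Cascade

variable {V : Type*} [NormedAddCommGroup V] [InnerProductSpace ℝ V]

/-- The semigroup `S` of endomorphisms `a` of `V` with `a C ⊆ C`. -/
def preservers (C : ProperCone ℝ V) : Set (V →L[ℝ] V) :=
  {a | ∀ x ∈ C, a x ∈ C}

/-- The set `S⁰` of those `a ∈ S` that map `C \ {0}` into the interior of `C`. -/
def strictPreservers (C : ProperCone ℝ V) : Set (V →L[ℝ] V) :=
  {a | a ∈ preservers C ∧ ∀ x ∈ C, x ≠ 0 → a x ∈ interior (C : Set V)}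

/-- Condition `(𝒞)` for a set `Γ` of endomorphisms: no proper linear subspace `W` that meets `C`
outside `0` is mapped into itself by all of `Γ`, and `Γ` meets `S⁰`. -/
def ConditionC (C : ProperCone ℝ V) (Γ : Set (V →L[ℝ] V)) : Prop :=
  (∀ W : Submodule ℝ V, (∃ x ∈ W, x ∈ C ∧ x ≠ 0) → (∀ a ∈ Γ, ∀ x ∈ W, a x ∈ W) → W = ⊤) ∧
    (Γ ∩ strictPreservers C).Nonempty

/-- `[supp μ]`: the smallest closed subsemigroup of `End V` (multiplication is composition)
that contains the topological support of `μ`. If `μ` is carried by the closed semigroup `S`, it is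
contained in `S`. -/
def suppSemigroup (μ : Measure (V →L[ℝ] V)) : Subsemigroup (V →L[ℝ] V) :=
  sInf {Γ : Subsemigroup (V →L[ℝ] V) | IsClosed (Γ : Set (V →L[ℝ] V)) ∧
    μ.support ⊆ (Γ : Set (V →L[ℝ] V))}

/-- The left products `a (n-1) ∘ ⋯ ∘ a 1 ∘ a 0` of a sequence of endomorphisms. -/
def leftProd (a : ℕ → V →L[ℝ] V) : ℕ → V →L[ℝ] V
  | 0 => 1
  | n + 1 => a n * leftProd a n

/-- `E[|A|^s]` in `[0, ∞]`, for `A` of law `μ`. -/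
def normMoment (μ : Measure (V →L[ℝ] V)) (s : ℝ) : ℝ≥0∞ :=
  ∫⁻ a, ‖a‖ₑ ^ s ∂μ

/-- `E[|Aₙ ⋯ A₁|^s]` in `[0, ∞]`, for independent `A₁, A₂, …` of law `μ`. -/
def prodMoment (μ : Measure (V →L[ℝ] V)) [IsProbabilityMeasure μ] (s : ℝ) (n : ℕ) : ℝ≥0∞ :=
  ∫⁻ a, ‖leftProd a n‖ₑ ^ s ∂(Measure.infinitePi fun _ : ℕ => μ)

/-- The interval `I_μ = {s ≥ 0 : E[|A|^s] < ∞}`. -/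
def momentInterval (μ : Measure (V →L[ℝ] V)) : Set ℝ :=
  {s | 0 ≤ s ∧ normMoment μ s < ∞}

/-- `κ(s) = lim E[|Aₙ ⋯ A₁|^s]^(1/n)`. For `s ∈ I_μ` the sequence of moments is finite and
submultiplicative, so the limit exists and is the upper limit written here. -/
def kappa (μ : Measure (V →L[ℝ] V)) [IsProbabilityMeasure μ] (s : ℝ) : ℝ≥0∞ :=
  limsup (fun n : ℕ => prodMoment μ s n ^ (1 / (n : ℝ))) atTop

/-- `E[N^s]` in `[0, ∞]`, for `N` of law `ν`. -/
def countMoment (ν : Measure ℕ) (s : ℝ) : ℝ≥0∞ :=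
  ∫⁻ n, (n : ℝ≥0∞) ^ s ∂ν

/-- The random sum `∑_{i < N} Aᵢ Zᵢ` as a function of `N` and of the sequence `(Aᵢ, Zᵢ)`. -/
def randomSum (p : ℕ × (ℕ → (V →L[ℝ] V) × V)) : V :=
  ∑ i ∈ Finset.range p.1, (p.2 i).1 (p.2 i).2

lemma measurable_randomSum [FiniteDimensional ℝ V] [MeasurableSpace V] [BorelSpace V] :
    Measurable (randomSum (V := V)) := by
  refine measurable_from_prod_countable_right fun n => ?_
  have h : Continuous fun q : (V →L[ℝ] V) × V => q.1 q.2 := by fun_prop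
  have h' : ∀ i ∈ Finset.range n,
      Measurable fun w : ℕ → (V →L[ℝ] V) × V => (w i).1 (w i).2 :=
    fun i _ => h.measurable.comp (measurable_pi_apply i)
  simpa only [randomSum] using Finset.measurable_fun_sum (Finset.range n) h'

/-- The smoothing transform `T`: if `ν`, `μ`, `ρ` are the laws of `N`, `A`, `Z`, then `T ρ` is the
law of `∑_{i < N} Aᵢ Zᵢ`, where `N` and the `Aᵢ`, `Zᵢ` (copies of `A`, `Z`) are all independent. -/
def smoothing [MeasurableSpace V] (ν : Measure ℕ) (μ : Measure (V →L[ℝ] V))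
    [IsProbabilityMeasure μ] (ρ : Measure V) [IsProbabilityMeasure ρ] : Measure V :=
  (ν.prod (Measure.infinitePi fun _ : ℕ => μ.prod ρ)).map randomSum

/-- `ρ` is the law of a fixed point `Z` of the smoothing transform: a `C`-valued random vector with
finite nonzero mean whose law is invariant under `T`. -/
structure IsFixedPoint [MeasurableSpace V] (C : ProperCone ℝ V) (ν : Measure ℕ)
    (μ : Measure (V →L[ℝ] V)) [IsProbabilityMeasure μ] (ρ : Measure V) [IsProbabilityMeasure ρ] :
    Prop where
  mem_cone : ∀ᵐ z ∂ρ, z ∈ C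
  integrable : Integrable (fun z : V => z) ρ
  mean_ne_zero : ∫ z, z ∂ρ ≠ 0
  invariant : smoothing ν μ ρ = ρ

end Cascade

end

/-!
Let `m = E[N]`, let `Πₙ = Aₙ ⋯ A₁`, and test the fixed point equation against functionals `l` that
are nonnegative on `C`: the variable `⟨l, Z⟩` has the law of `∑_{i ≤ N} ⟨l, Aᵢ Zᵢ⟩`, a random sum
of independent nonnegative terms, each distributed as `⟨l ∘ A, Z⟩` with `A` independent of `Z`
(`testMoment_eq`). An inequality between moments of both sides, valid for all such `l`, can
therefore be iterated along the products `l ∘ Πₙ`. Condition `(𝒞)` enters only through the fact that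
`z = E[Z]` is an interior point of `C` (`mean_mem_interior`). Hence, for a functional `f` that is
comparable to the norm on `C`, `|a|` is comparable to `⟨f, a z⟩` for all `a` that preserve `C`.

*Necessity.* As `h > 1` and at least two terms contribute, strict superadditivity of `t ↦ t ^ h`
gives `m E⟨l ∘ A, Z⟩ ^ h + c |l| ^ h ≤ E⟨l, Z⟩ ^ h` with `c > 0`
(`exists_mul_lintegral_add_le_testMoment`). Since `E⟨l, Z⟩ ^ h ≤ |l| ^ h E|Z| ^ h`, this is a strict
contraction; its iterates show that `m ^ n E|Πₙ| ^ h` decays geometrically, so that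
`κ(h) < 1 / m` (`geometricDecay_of_moment`). Jensen's inequality conditionally on `N` bounds
`E[N ^ h]` (`countMoment_lt_top_of_moment`).

*Sufficiency.* Put `h = p + 1` and let `φ(t) = t min(t, L) ^ p`, a truncation of `t ^ h`. If
`E|Z| ^ p` is finite, then `E φ⟨l, Z⟩ ≤ m E φ⟨l ∘ A, Z⟩ + B |l| ^ h` with `B` independent of `L`,
because the error consists of products of two different terms of the sum
(`exists_testMoment_truncPow_le`). In the iteration the errors add up to a geometric series. The
remainder `m ^ n E φ⟨f ∘ Πₙ, Z⟩` vanishes in the limit: after `Z` is split at a level `R`, one part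
is `O(m ^ n E|Πₙ| ^ h)`, and the other is at most `m ^ n E|Πₙ|`, which is bounded, times
`|f| L ^ p E[|Z|; |Z| > R]`. Letting `L` tend to infinity yields `E|Z| ^ h < ∞`
(`moment_lt_top_of_geometricDecay`). The exponents are reached in steps of one, starting from
`E|Z| < ∞`; as `m ^ n E|Πₙ|` is bounded, log-convexity of moments extends the decay at `h` to
all exponents in `(1, h]` (`GeometricDecay.interpolate`).
-/

namespace Cascade

/-! ### Power inequalities in `[0, ∞]` -/

lemma rpow_eq_mul_rpow_sub_one (x : ℝ≥0∞) {h : ℝ} (hh : 1 ≤ h) : x ^ h = x * x ^ (h - 1) := by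
  conv_lhs => rw [show h = 1 + (h - 1) by ring,
    ENNReal.rpow_add_of_nonneg _ _ zero_le_one (by linarith), ENNReal.rpow_one]

/-- A quantitative form of the strict superadditivity of `t ↦ t ^ h` for `h > 1`. -/
lemma rpow_add_rpow_add_min_le (s t : ℝ≥0∞) {h : ℝ} (hh : 1 ≤ h) :
    s ^ h + t ^ h + (2 ^ (h - 1) - 1) * min s t ^ h ≤ (s + t) ^ h := by
  wlog hst : s ≤ t generalizing s t
  · have := this t s (le_of_not_ge hst)
    rwa [min_comm, add_comm s t, add_comm (s ^ h)]
  have hp : 0 ≤ h - 1 := by linarith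
  have h1 : (1 : ℝ≥0∞) ≤ 2 ^ (h - 1) := by
    simpa using ENNReal.rpow_le_rpow (show (1 : ℝ≥0∞) ≤ 2 by norm_num) hp
  rw [min_eq_left hst]
  calc s ^ h + t ^ h + (2 ^ (h - 1) - 1) * s ^ h
      = ((2 ^ (h - 1) - 1) + 1) * s ^ h + t ^ h := by ring
    _ = s * (2 * s) ^ (h - 1) + t * t ^ (h - 1) := by
        rw [tsub_add_cancel_of_le h1, ENNReal.mul_rpow_of_nonneg _ _ hp,
          rpow_eq_mul_rpow_sub_one s hh, rpow_eq_mul_rpow_sub_one t hh]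
        ring
    _ ≤ s * (s + t) ^ (h - 1) + t * (s + t) ^ (h - 1) := by
        gcongr
        · rw [two_mul]; gcongr
        · exact le_add_self
    _ = (s + t) ^ h := by rw [← add_mul, ← rpow_eq_mul_rpow_sub_one _ hh]

lemma sum_rpow_le_rpow_sum {ι : Type*} (s : Finset ι) (x : ι → ℝ≥0∞) {h : ℝ} (hh : 1 ≤ h) :
    ∑ i ∈ s, x i ^ h ≤ (∑ i ∈ s, x i) ^ h := by
  classical
  induction s using Finset.induction_on with
  | empty => simp
  | insert a s ha ih =>
    rw [Finset.sum_insert ha, Finset.sum_insert ha]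
    exact (add_le_add_right ih _).trans (ENNReal.add_rpow_le_rpow_add _ _ hh)

lemma sum_rpow_add_min_le (x : ℕ → ℝ≥0∞) {h : ℝ} (hh : 1 ≤ h) {n : ℕ} (hn : 2 ≤ n) :
    ∑ i ∈ Finset.range n, x i ^ h + (2 ^ (h - 1) - 1) * min (x 0) (x 1) ^ h
      ≤ (∑ i ∈ Finset.range n, x i) ^ h := by
  obtain ⟨m, rfl⟩ := Nat.exists_eq_add_of_le hn
  rw [Finset.sum_range_add, Finset.sum_range_add]
  simp only [Finset.sum_range_succ, Finset.sum_range_zero, zero_add]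
  calc _ = (x 0 ^ h + x 1 ^ h + (2 ^ (h - 1) - 1) * min (x 0) (x 1) ^ h)
        + ∑ i ∈ Finset.range m, x (2 + i) ^ h := by ring
    _ ≤ (x 0 + x 1) ^ h + (∑ i ∈ Finset.range m, x (2 + i)) ^ h :=
        add_le_add (rpow_add_rpow_add_min_le _ _ hh) (sum_rpow_le_rpow_sum _ _ hh)
    _ ≤ _ := ENNReal.add_rpow_le_rpow_add _ _ hh

/-- Both regimes of the power of a sum at once: subadditivity, with constant `1`, if `p ≤ 1`, and
convexity, with constant `n ^ (p - 1)`, if `p ≥ 1`. -/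
lemma rpow_sum_le {ι : Type*} (s : Finset ι) (x : ι → ℝ≥0∞) {p : ℝ} (hp : 0 < p) {n : ℕ}
    (hs : s.card ≤ n) :
    (∑ i ∈ s, x i) ^ p ≤ (n : ℝ≥0∞) ^ (max (p - 1) 0) * ∑ i ∈ s, x i ^ p := by
  classical
  rcases le_total 1 p with h1 | h1
  · rw [max_eq_left (by linarith)]
    refine (ENNReal.rpow_sum_le_const_mul_sum_rpow s x h1).trans ?_
    gcongr
  · rw [max_eq_right (by linarith), ENNReal.rpow_zero, one_mul]
    clear hs
    induction s using Finset.induction_on with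
    | empty => simp [hp]
    | insert a s ha ih =>
      rw [Finset.sum_insert ha, Finset.sum_insert ha]
      exact (ENNReal.rpow_add_le_add_rpow _ _ hp.le h1).trans (add_le_add_right ih _)

lemma add_rpow_le_of_one_le {m r p : ℝ} (hm : 0 ≤ m) (hr : 0 ≤ r) (hp : 1 ≤ p) :
    (m + r) ^ p ≤ m ^ p + p * r * (m + r) ^ (p - 1) := by
  rcases eq_or_lt_of_le (add_nonneg hm hr) with h0 | h0
  · have : m = 0 := by linarith
    have : r = 0 := by linarith
    subst m; subst r; simp
  · -- Bernoulli's inequality at `m / (m + r) = 1 - r / (m + r)`.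
    have hb := one_add_mul_self_le_rpow_one_add (s := -(r / (m + r)))
      (by rw [neg_le_neg_iff, div_le_one h0]; linarith) hp
    have he : 1 + -(r / (m + r)) = m / (m + r) := by field_simp; ring
    rw [he, Real.div_rpow hm h0.le, le_div_iff₀ (Real.rpow_pos_of_pos h0 p)] at hb
    have hq : (m + r) ^ p = (m + r) * (m + r) ^ (p - 1) := by
      rw [← Real.rpow_one_add' h0.le (by linarith)]; congr 1; ring
    have : r / (m + r) * (m + r) ^ p = r * (m + r) ^ (p - 1) := by
      rw [hq]; field_simp
    nlinarith

lemma add_rpow_le_two_rpow_mul (m r : ℝ≥0∞) {p : ℝ} (hp : 0 ≤ p) :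
    (m + r) ^ p ≤ 2 ^ p * (m ^ p + r ^ p) := by
  wlog hmr : m ≤ r generalizing m r
  · have := this r m (le_of_not_ge hmr)
    rwa [add_comm m, add_comm (m ^ p)]
  calc (m + r) ^ p ≤ (2 * r) ^ p := by rw [two_mul]; gcongr
    _ = 2 ^ p * r ^ p := ENNReal.mul_rpow_of_nonneg _ _ hp
    _ ≤ _ := by gcongr; exact le_add_self

/-- The cross terms that appear when `t ↦ t * min t L ^ p` is applied to `x + r`; the constant does
not depend on the truncation level `L`. -/
lemma exists_mul_min_add_rpow_le {p : ℝ} (hp : 0 < p) :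
    ∃ c : ℝ≥0∞, c ≠ ∞ ∧ ∀ L x r : ℝ≥0∞, x ≠ ∞ → r ≠ ∞ →
      x * min (x + r) L ^ p ≤ x * min x L ^ p + c * (x * r ^ p + r * x ^ p) := by
  have hmin : ∀ L x r : ℝ≥0∞, min (x + r) L ≤ min x L + r := fun L x r => by
    rw [min_add]
    exact min_le_min le_rfl le_self_add
  rcases le_total p 1 with h1 | h1
  · refine ⟨1, ENNReal.one_ne_top, fun L x r _ _ => ?_⟩
    calc x * min (x + r) L ^ p ≤ x * (min x L ^ p + r ^ p) := by
          gcongr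
          exact (ENNReal.rpow_le_rpow (hmin L x r) hp.le).trans
            (ENNReal.rpow_add_le_add_rpow _ _ hp.le h1)
      _ ≤ _ := by rw [mul_add, one_mul]; gcongr; exact le_self_add
  · refine ⟨ENNReal.ofReal p * 2 ^ (p - 1), by finiteness, fun L x r hx hr => ?_⟩
    have hp1 : 0 ≤ p - 1 := by linarith
    set m := min x L with hm
    have hmx : m ≤ x := min_le_left _ _
    have hmt : m ≠ ∞ := ne_top_of_le_ne_top hx hmx
    have key : (m + r) ^ p ≤ m ^ p + ENNReal.ofReal p * r * (m + r) ^ (p - 1) := by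
      clear_value m
      lift m to NNReal using hmt
      lift r to NNReal using hr
      have := add_rpow_le_of_one_le m.coe_nonneg r.coe_nonneg h1
      rw [← ENNReal.ofReal_coe_nnreal (p := m), ← ENNReal.ofReal_coe_nnreal (p := r),
        ← ENNReal.ofReal_add m.coe_nonneg r.coe_nonneg,
        ENNReal.ofReal_rpow_of_nonneg (add_nonneg m.coe_nonneg r.coe_nonneg) hp.le,
        ENNReal.ofReal_rpow_of_nonneg m.coe_nonneg hp.le,
        ENNReal.ofReal_rpow_of_nonneg (add_nonneg m.coe_nonneg r.coe_nonneg) hp1,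
        ← ENNReal.ofReal_mul hp.le, ← ENNReal.ofReal_mul (mul_nonneg hp.le r.coe_nonneg),
        ← ENNReal.ofReal_add (Real.rpow_nonneg m.coe_nonneg _) (by positivity)]
      exact ENNReal.ofReal_le_ofReal this
    calc x * min (x + r) L ^ p
        ≤ x * (m ^ p + ENNReal.ofReal p * r * (2 ^ (p - 1) * (m ^ (p - 1) + r ^ (p - 1)))) := by
          gcongr
          refine (ENNReal.rpow_le_rpow (hmin L x r) hp.le).trans (key.trans ?_)
          gcongr
          exact add_rpow_le_two_rpow_mul _ _ hp1
      _ ≤ x * (m ^ p + ENNReal.ofReal p * r * (2 ^ (p - 1) * (x ^ (p - 1) + r ^ (p - 1)))) := by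
          gcongr
      _ = _ := by
          rw [rpow_eq_mul_rpow_sub_one r h1, rpow_eq_mul_rpow_sub_one x h1]
          ring

/-- The truncated power `t * min t L ^ p` of a sum of `n` finite terms, up to cross terms that
involve two different indices each. -/
lemma exists_trunc_sum_le {p : ℝ} (hp : 0 < p) :
    ∃ c : ℝ≥0∞, c ≠ ∞ ∧ ∀ (L : ℝ≥0∞) (n : ℕ) (x : ℕ → ℝ≥0∞), (∀ i, x i ≠ ∞) →
      (∑ i ∈ Finset.range n, x i) * min (∑ i ∈ Finset.range n, x i) L ^ p ≤
        ∑ i ∈ Finset.range n, x i * min (x i) L ^ p +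
          c * (n : ℝ≥0∞) ^ (max (p - 1) 0) * ∑ i ∈ Finset.range n,
            ∑ j ∈ (Finset.range n).erase i, (x i * x j ^ p + x j * x i ^ p) := by
  obtain ⟨c, hc, H⟩ := exists_mul_min_add_rpow_le hp
  refine ⟨c, hc, fun L n x hx => ?_⟩
  rw [Finset.sum_mul, Finset.mul_sum, ← Finset.sum_add_distrib]
  refine Finset.sum_le_sum fun i hi => ?_
  have hn : 1 ≤ n := by have := Finset.mem_range.1 hi; omega
  have hN : (1 : ℝ≥0∞) ≤ (n : ℝ≥0∞) ^ (max (p - 1) 0) := by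
    simpa using ENNReal.rpow_le_rpow (show (1 : ℝ≥0∞) ≤ n by exact_mod_cast hn)
      (le_max_right (p - 1) 0)
  rw [← Finset.add_sum_erase _ _ hi]
  refine (H L (x i) _ (hx i) (ENNReal.sum_ne_top.2 fun j _ => hx j)).trans ?_
  rw [mul_assoc]
  gcongr
  rw [Finset.sum_add_distrib, mul_add]
  refine add_le_add ?_ ?_
  · rw [← Finset.mul_sum, mul_left_comm]
    gcongr
    exact rpow_sum_le _ _ hp ((Finset.card_erase_le).trans (by simp))
  · rw [← Finset.sum_mul]
    exact le_mul_of_one_le_left' hN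

/-! ### Hölder and Jensen inequalities for lower integrals -/

lemma rpow_lintegral_le {α : Type*} [MeasurableSpace α] (P : Measure α) [IsProbabilityMeasure P]
    {f : α → ℝ≥0∞} (hf : AEMeasurable f P) {p : ℝ} (hp : 1 ≤ p) :
    (∫⁻ x, f x ∂P) ^ p ≤ ∫⁻ x, f x ^ p ∂P := by
  have hp0 : 0 < p := by linarith
  have := ENNReal.lintegral_mul_norm_pow_le (μ := P) (hf.pow_const p)
    (aemeasurable_const (b := (1 : ℝ≥0∞))) (p := 1 / p) (q := 1 - 1 / p) (by positivity)
    (by rw [sub_nonneg, div_le_one hp0]; exact hp) (by ring)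
  simp only [← ENNReal.rpow_mul, mul_one_div_cancel hp0.ne', ENNReal.rpow_one, ENNReal.one_rpow,
    mul_one, lintegral_const, measure_univ] at this
  calc _ ≤ ((∫⁻ x, f x ^ p ∂P) ^ (1 / p)) ^ p := by gcongr
    _ = _ := by rw [← ENNReal.rpow_mul, one_div_mul_cancel hp0.ne', ENNReal.rpow_one]

/-- Log-convexity of moments, at an exponent `θ + (1 - θ) h` between `1` and `h`. -/
lemma lintegral_rpow_interpolate {α : Type*} [MeasurableSpace α] (P : Measure α)
    {f : α → ℝ≥0∞} (hf : AEMeasurable f P) {h θ : ℝ} (hh : 0 ≤ h) (h0 : 0 ≤ θ) (h1 : θ ≤ 1) :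
    ∫⁻ x, f x ^ (θ + (1 - θ) * h) ∂P
      ≤ (∫⁻ x, f x ∂P) ^ θ * (∫⁻ x, f x ^ h ∂P) ^ (1 - θ) := by
  have := ENNReal.lintegral_mul_norm_pow_le (μ := P) hf (hf.pow_const h) (p := θ) (q := 1 - θ)
    h0 (by linarith) (by ring)
  refine le_trans (le_of_eq (lintegral_congr fun x => ?_)) this
  rw [← ENNReal.rpow_mul, mul_comm h, ENNReal.rpow_add_of_nonneg _ _ h0
    (mul_nonneg (by linarith) hh)]

lemma lintegral_rpow_lt_top_of_le {α : Type*} [MeasurableSpace α] (P : Measure α)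
    [IsProbabilityMeasure P] {f : α → ℝ≥0∞} {p q : ℝ} (hp : 0 ≤ p) (hpq : p ≤ q)
    (hq : ∫⁻ x, f x ^ q ∂P < ∞) : ∫⁻ x, f x ^ p ∂P < ∞ := by
  have : ∀ x, f x ^ p ≤ 1 + f x ^ q := fun x => by
    rcases le_total 1 (f x) with h | h
    · exact (ENNReal.rpow_le_rpow_of_exponent_le h hpq).trans le_add_self
    · exact (ENNReal.rpow_le_one h hp).trans le_self_add
  calc _ ≤ ∫⁻ x, 1 + f x ^ q ∂P := lintegral_mono this
    _ = 1 + ∫⁻ x, f x ^ q ∂P := by rw [lintegral_add_left measurable_const]; simp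
    _ < ∞ := ENNReal.add_lt_top.2 ⟨ENNReal.one_lt_top, hq⟩

/-! ### Sums of independent identically distributed terms -/

section iid

variable {E : Type*} [MeasurableSpace E] (P : Measure E) [IsProbabilityMeasure P]

lemma lintegral_eval_infinitePi {g : E → ℝ≥0∞} (hg : Measurable g) (i : ℕ) :
    ∫⁻ w, g (w i) ∂(Measure.infinitePi fun _ : ℕ => P) = ∫⁻ x, g x ∂P :=
  (measurePreserving_eval_infinitePi (fun _ : ℕ => P) i).lintegral_comp hg

lemma lintegral_mul_eval_infinitePi {f g : E → ℝ≥0∞} (hf : Measurable f) (hg : Measurable g)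
    {i j : ℕ} (hij : i ≠ j) :
    ∫⁻ w, f (w i) * g (w j) ∂(Measure.infinitePi fun _ : ℕ => P)
      = (∫⁻ x, f x ∂P) * ∫⁻ x, g x ∂P := by
  have hI := (ProbabilityTheory.iIndepFun_infinitePi (P := fun _ : ℕ => P)
    (X := fun _ x => x) fun _ => measurable_id).indepFun hij
  rw [← lintegral_eval_infinitePi P hf i, ← lintegral_eval_infinitePi P hg j]
  exact ProbabilityTheory.lintegral_mul_eq_lintegral_mul_lintegral_of_indepFun
    (hf.comp (measurable_pi_apply i)) (hg.comp (measurable_pi_apply j)) (hI.comp hf hg)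

lemma lintegral_sum_eval {X : E → ℝ≥0∞} (hX : Measurable X) (n : ℕ) :
    ∫⁻ w, ∑ i ∈ Finset.range n, X (w i) ∂(Measure.infinitePi fun _ : ℕ => P)
      = n * ∫⁻ x, X x ∂P := by
  rw [lintegral_finsetSum _ fun i _ => by fun_prop]
  simp [lintegral_eval_infinitePi P hX]

/-- Lower bound for a moment of a sum of at least two terms: besides the moments of the terms there
is a gain from the event that two of the terms exceed a level `a`. -/
lemma lintegral_sum_rpow_ge {X : E → ℝ≥0∞} (hX : Measurable X) {h : ℝ} (hh : 1 ≤ h) (a : ℝ≥0∞)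
    {n : ℕ} (hn : 2 ≤ n) :
    n * ∫⁻ x, X x ^ h ∂P + (2 ^ (h - 1) - 1) * (a ^ h * P {x | a < X x} ^ 2)
      ≤ ∫⁻ w, (∑ i ∈ Finset.range n, X (w i)) ^ h ∂(Measure.infinitePi fun _ : ℕ => P) := by
  have hs : MeasurableSet {x | a < X x} := measurableSet_lt measurable_const hX
  let u : E → ℝ≥0∞ := {x | a < X x}.indicator 1
  have hu : Measurable u := measurable_one.indicator hs
  have hPu : ∫⁻ x, u x ∂P = P {x | a < X x} := lintegral_indicator_one hs
  rw [pow_two]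
  nth_rewrite 1 [← hPu]
  rw [← hPu, ← lintegral_mul_eval_infinitePi P hu hu (i := 0) (j := 1) (by norm_num),
    ← lintegral_sum_eval P (hX.pow_const h),
    ← lintegral_const_mul _ (by fun_prop), ← lintegral_const_mul _ (by fun_prop),
    ← lintegral_add_left (by fun_prop)]
  refine lintegral_mono fun w => le_trans ?_ (sum_rpow_add_min_le (fun i => X (w i)) hh hn)
  gcongr
  by_cases h0 : a < X (w 0)
  · by_cases h1 : a < X (w 1)
    · simp only [u, Set.indicator_of_mem (show w 0 ∈ {x | a < X x} from h0),
        Set.indicator_of_mem (show w 1 ∈ {x | a < X x} from h1), Pi.one_apply, mul_one]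
      exact ENNReal.rpow_le_rpow (le_min h0.le h1.le) (by linarith)
    · simp [u, h1]
  · simp [u, h0]

/-- Upper bound for a truncated moment of a sum of `n` terms, uniform in the truncation level. -/
lemma exists_lintegral_trunc_sum_le {p : ℝ} (hp : 0 < p) :
    ∃ c : ℝ≥0∞, c ≠ ∞ ∧ ∀ (X : E → ℝ≥0∞), Measurable X → (∀ x, X x ≠ ∞) →
      ∀ (L : ℝ≥0∞) (n : ℕ),
      ∫⁻ w, (∑ i ∈ Finset.range n, X (w i)) * min (∑ i ∈ Finset.range n, X (w i)) L ^ p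
          ∂(Measure.infinitePi fun _ : ℕ => P)
        ≤ n * ∫⁻ x, X x * min (X x) L ^ p ∂P +
          c * (n : ℝ≥0∞) ^ (max (p + 1) 2) * ((∫⁻ x, X x ∂P) * ∫⁻ x, X x ^ p ∂P) := by
  obtain ⟨c, hc, H⟩ := exists_trunc_sum_le hp
  refine ⟨c * 2, by finiteness, fun X hX hXt L n => ?_⟩
  have hXp := hX.pow_const p
  have hT : Measurable fun x => X x * min (X x) L ^ p := by fun_prop
  have hm : ∀ i, Measurable fun w : ℕ → E => X (w i) := fun i => by fun_prop
  refine (lintegral_mono fun (w : ℕ → E) => H L n (fun i => X (w i)) fun _ => hXt _).trans ?_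
  rw [lintegral_add_left (by fun_prop), lintegral_sum_eval P hT,
    lintegral_const_mul _ (by fun_prop), lintegral_finsetSum _ fun i _ => by fun_prop]
  refine add_le_add_right ?_ _
  have hcross : ∀ i ∈ Finset.range n, ∫⁻ w, ∑ j ∈ (Finset.range n).erase i,
      (X (w i) * X (w j) ^ p + X (w j) * X (w i) ^ p) ∂(Measure.infinitePi fun _ : ℕ => P)
        ≤ n * (2 * ((∫⁻ x, X x ∂P) * ∫⁻ x, X x ^ p ∂P)) := by
    intro i _
    rw [lintegral_finsetSum _ fun i _ => by fun_prop]
    refine (Finset.sum_le_card_nsmul _ _ (2 * ((∫⁻ x, X x ∂P) * ∫⁻ x, X x ^ p ∂P))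
      fun j hj => ?_).trans ?_
    · have hij := Finset.ne_of_mem_erase hj
      rw [lintegral_add_left (by fun_prop), lintegral_mul_eval_infinitePi P hX hXp hij.symm,
        lintegral_mul_eval_infinitePi P hX hXp hij, two_mul]
    · rw [nsmul_eq_mul]
      gcongr
      exact_mod_cast (Finset.card_erase_le).trans (by simp)
  refine (mul_le_mul_right (Finset.sum_le_card_nsmul _ _ _ hcross) _).trans (le_of_eq ?_)
  have hpow : (n : ℝ≥0∞) ^ (max (p + 1) 2) = (n : ℝ≥0∞) ^ (max (p - 1) 0) * (n * n) := by
    rw [show max (p + 1) 2 = max (p - 1) 0 + 2 by rw [max_add]; congr 1 <;> ring,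
      ENNReal.rpow_add_of_nonneg _ _ (le_max_right _ _) (by norm_num), ENNReal.rpow_two, pow_two]
  rw [hpow, Finset.card_range, nsmul_eq_mul]
  ring

end iid

/-! ### The law of the product of `n` independent endomorphisms -/

section powLaw

variable {V : Type*} [NormedAddCommGroup V] [InnerProductSpace ℝ V]

lemma leftProd_congr {a b : ℕ → V →L[ℝ] V} {n : ℕ} (h : ∀ i < n, a i = b i) :
    leftProd a n = leftProd b n := by
  induction n with
  | zero => rfl
  | succ n ih =>
    rw [leftProd, leftProd, h n n.lt_succ_self, ih fun i hi => h i (hi.trans n.lt_succ_self)]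

lemma isClosed_preservers (C : ProperCone ℝ V) : IsClosed (preservers C) := by
  have : preservers C = ⋂ x ∈ C, (fun a : V →L[ℝ] V => a x) ⁻¹' C := by
    ext a; simp [preservers]
  rw [this]
  exact isClosed_biInter fun x _ => C.isClosed.preimage (by fun_prop)

/-- The law of `Aₙ ⋯ A₁`, for independent `A₁, A₂, …` of law `μ`. -/
noncomputable def powLaw (μ : Measure (V →L[ℝ] V)) [IsProbabilityMeasure μ] (n : ℕ) :
    Measure (V →L[ℝ] V) :=
  (Measure.infinitePi fun _ : ℕ => μ).map fun a => leftProd a n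

lemma powLaw_zero (μ : Measure (V →L[ℝ] V)) [IsProbabilityMeasure μ] :
    powLaw μ 0 = Measure.dirac 1 := by
  simp [powLaw, leftProd, Measure.map_const]

variable [FiniteDimensional ℝ V]

lemma measurable_leftProd (n : ℕ) : Measurable fun a : ℕ → V →L[ℝ] V => leftProd a n := by
  induction n with
  | zero => exact measurable_const
  | succ n ih => exact (measurable_pi_apply n).mul ih

variable (μ : Measure (V →L[ℝ] V)) [IsProbabilityMeasure μ]

instance (n : ℕ) : IsProbabilityMeasure (powLaw μ n) :=
  Measure.isProbabilityMeasure_map (measurable_leftProd n).aemeasurable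

lemma prodMoment_eq (s : ℝ) (n : ℕ) : prodMoment μ s n = ∫⁻ a, ‖a‖ₑ ^ s ∂(powLaw μ n) := by
  rw [powLaw, lintegral_map (by fun_prop) (measurable_leftProd n), prodMoment]

lemma powLaw_succ_eq_mconv_left (n : ℕ) : powLaw μ (n + 1) = μ ∗ₘ powLaw μ n := by
  have hI := (ProbabilityTheory.iIndepFun_infinitePi (P := fun _ : ℕ => μ)
    (X := fun _ x => x) fun _ => measurable_id).indepFun_finset {n} (Finset.range n) (by simp)
    fun i => measurable_pi_apply i
  have hg : Measurable fun t : Finset.range n → (V →L[ℝ] V) =>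
      leftProd (fun i => if h : i ∈ Finset.range n then t ⟨i, h⟩ else 1) n := by
    refine (measurable_leftProd n).comp (measurable_pi_lambda _ fun i => ?_)
    by_cases h : i ∈ Finset.range n
    · simpa only [h, dif_pos] using measurable_pi_apply _
    · simp only [dif_neg h]
      exact measurable_const
  have hφ : Measurable fun t : ({n} : Finset ℕ) → (V →L[ℝ] V) => t ⟨n, by simp⟩ :=
    measurable_pi_apply _
  have hI2 := hI.comp hφ hg
  have he : ((fun t : Finset.range n → (V →L[ℝ] V) =>
      leftProd (fun i => if h : i ∈ Finset.range n then t ⟨i, h⟩ else 1) n) ∘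
      fun (a : ℕ → V →L[ℝ] V) (i : Finset.range n) => a i) = fun a => leftProd a n := by
    funext a
    refine leftProd_congr fun i hi => ?_
    simp [hi]
  rw [he] at hI2
  have hp := (ProbabilityTheory.indepFun_iff_map_prod_eq_prod_map_map
    (by exact (measurable_pi_apply n).aemeasurable) (measurable_leftProd n).aemeasurable).1 hI2
  have hm : Measure.map ((fun t : ({n} : Finset ℕ) → (V →L[ℝ] V) => t ⟨n, by simp⟩) ∘
      fun (a : ℕ → V →L[ℝ] V) (i : ({n} : Finset ℕ)) => a i)
      (Measure.infinitePi fun _ : ℕ => μ) = μ := Measure.infinitePi_map_eval (fun _ : ℕ => μ) n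
  rw [hm] at hp
  rw [Measure.mconv, powLaw, powLaw, ← hp, Measure.map_map (by fun_prop)
    (by exact (measurable_pi_apply n).prodMk (measurable_leftProd n))]
  rfl

/-- The law of a product of `n + 1` independent factors, with the new factor on the right. -/
lemma powLaw_succ_eq_mconv_right (n : ℕ) : powLaw μ (n + 1) = powLaw μ n ∗ₘ μ := by
  induction n with
  | zero =>
    rw [powLaw_succ_eq_mconv_left, powLaw_zero, Measure.mconv_dirac_one, Measure.dirac_one_mconv]
  | succ n ih =>
    rw [powLaw_succ_eq_mconv_left μ (n + 1)]
    conv_lhs => rw [ih]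
    rw [← Measure.mconv_assoc, ← powLaw_succ_eq_mconv_left]

lemma powLaw_one : powLaw μ 1 = μ := by
  rw [powLaw_succ_eq_mconv_left, powLaw_zero, Measure.mconv_dirac_one]

lemma lintegral_powLaw_succ {F : (V →L[ℝ] V) → ℝ≥0∞} (hF : Measurable F) (n : ℕ) :
    ∫⁻ b, F b ∂(powLaw μ (n + 1)) = ∫⁻ b, ∫⁻ a, F (b * a) ∂μ ∂(powLaw μ n) := by
  rw [powLaw_succ_eq_mconv_right, Measure.lintegral_mconv hF]

lemma ae_powLaw_mem_preservers {C : ProperCone ℝ V} (hμ : ∀ᵐ a ∂μ, a ∈ preservers C) (n : ℕ) :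
    ∀ᵐ b ∂(powLaw μ n), b ∈ preservers C := by
  refine (ae_map_iff (measurable_leftProd n).aemeasurable
    (isClosed_preservers C).measurableSet).2 ?_
  have : ∀ᵐ a ∂(Measure.infinitePi fun _ : ℕ => μ), ∀ i, a i ∈ preservers C :=
    ae_all_iff.2 fun i =>
      (measurePreserving_eval_infinitePi (fun _ : ℕ => μ) i).quasiMeasurePreserving.ae hμ
  filter_upwards [this] with a ha
  clear this
  induction n with
  | zero => exact fun x hx => hx
  | succ n ih => exact fun x hx => ha n _ (ih x hx)

/-- Moments of products are submultiplicative, hence finite when those of one factor are. -/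
lemma prodMoment_lt_top {s : ℝ} (hs : 0 ≤ s) (hμ : normMoment μ s < ∞) (n : ℕ) :
    prodMoment μ s n < ∞ := by
  rw [prodMoment_eq]
  induction n with
  | zero =>
    rw [powLaw_zero, lintegral_dirac' _ (by fun_prop)]
    exact ENNReal.rpow_lt_top_of_nonneg hs enorm_ne_top
  | succ n ih =>
    rw [lintegral_powLaw_succ μ (by fun_prop)]
    calc ∫⁻ b, ∫⁻ a, ‖b * a‖ₑ ^ s ∂μ ∂(powLaw μ n)
        ≤ ∫⁻ b, ∫⁻ a, ‖b‖ₑ ^ s * ‖a‖ₑ ^ s ∂μ ∂(powLaw μ n) := by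
          refine lintegral_mono fun b => lintegral_mono fun a => ?_
          dsimp only
          rw [← ENNReal.mul_rpow_of_nonneg _ _ hs]
          exact ENNReal.rpow_le_rpow (ContinuousLinearMap.opENorm_comp_le b a) hs
      _ = (∫⁻ b, ‖b‖ₑ ^ s ∂(powLaw μ n)) * normMoment μ s := by
          rw [normMoment, ← lintegral_mul_const _ (by fun_prop)]
          exact lintegral_congr fun b => lintegral_const_mul _ (by fun_prop)
      _ < ∞ := ENNReal.mul_lt_top ih hμ

end powLaw

/-! ### Linear functionals that are nonnegative on the cone -/

section dual

variable {V : Type*} [NormedAddCommGroup V] [InnerProductSpace ℝ V]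

/-- The dual cone: the linear functionals that are nonnegative on `C`. -/
def dualSet (C : ProperCone ℝ V) : Set (V →L[ℝ] ℝ) :=
  {l | ∀ x ∈ C, 0 ≤ l x}

lemma comp_mem_dualSet {C : ProperCone ℝ V} {l : V →L[ℝ] ℝ} (hl : l ∈ dualSet C)
    {a : V →L[ℝ] V} (ha : a ∈ preservers C) : l.comp a ∈ dualSet C :=
  fun x hx => hl _ (ha x hx)

lemma enorm_comp_le (l : V →L[ℝ] ℝ) (a : V →L[ℝ] V) : ‖l.comp a‖ₑ ≤ ‖l‖ₑ * ‖a‖ₑ :=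
  ContinuousLinearMap.opENorm_comp_le l a

lemma measurable_comp_left {G : (V →L[ℝ] ℝ) → ℝ≥0∞} (hG : Measurable G) (f : V →L[ℝ] ℝ) :
    Measurable fun a : V →L[ℝ] V => G (f.comp a) := by
  have h : Continuous fun a : V →L[ℝ] V => f.comp a := by fun_prop
  exact hG.comp h.measurable

lemma ofReal_apply_le (l : V →L[ℝ] ℝ) (x : V) : ENNReal.ofReal (l x) ≤ ‖l‖ₑ * ‖x‖ₑ := by
  rw [← ofReal_norm, ← ofReal_norm, ← ENNReal.ofReal_mul (norm_nonneg _)]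
  exact ENNReal.ofReal_le_ofReal ((le_abs_self _).trans (l.le_opNorm x))

lemma exists_ball_subset {C : ProperCone ℝ V} {z : V} (hz : z ∈ interior (C : Set V)) :
    ∃ ε > 0, ∀ v : V, ‖v‖ ≤ ε → z + v ∈ C := by
  obtain ⟨ε, hε, hb⟩ := Metric.mem_nhds_iff.1 (mem_interior_iff_mem_nhds.1 hz)
  refine ⟨ε / 2, half_pos hε, fun v hv => hb ?_⟩
  rw [Metric.mem_ball, dist_eq_norm, add_sub_cancel_left]
  linarith

lemma exists_mul_norm_le_apply {C : ProperCone ℝ V} {z : V} (hz : z ∈ interior (C : Set V)) :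
    ∃ ε > 0, ∀ l ∈ dualSet C, ε * ‖l‖ ≤ l z := by
  obtain ⟨ε, hε, hb⟩ := exists_ball_subset hz
  refine ⟨ε, hε, fun l hl => ?_⟩
  have hlz : 0 ≤ l z := by simpa using hl _ (hb 0 (by simpa using hε.le))
  rw [mul_comm, ← le_div_iff₀ hε]
  refine ContinuousLinearMap.opNorm_le_bound _ (by positivity) fun v => ?_
  rcases eq_or_ne v 0 with rfl | hv
  · simp
  have hn : 0 < ‖v‖ := norm_pos_iff.2 hv
  have hw : ‖(ε / ‖v‖) • v‖ ≤ ε := by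
    rw [norm_smul, Real.norm_of_nonneg (by positivity), div_mul_cancel₀ _ hn.ne']
  have h1 := hl _ (hb _ hw)
  have h2 := hl _ (hb (-((ε / ‖v‖) • v)) (by rwa [norm_neg]))
  simp only [map_add, map_neg, map_smul, smul_eq_mul] at h1 h2
  have h3 : ε / ‖v‖ * |l v| ≤ l z := by
    rcases abs_cases (l v) with ⟨h, _⟩ | ⟨h, _⟩ <;> rw [h] <;> linarith
  rw [Real.norm_eq_abs, div_mul_eq_mul_div, le_div_iff₀ hε]
  rw [div_mul_eq_mul_div, div_le_iff₀ hn] at h3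
  linarith

/-- A salient closed cone in a finite-dimensional space has a linear functional that is comparable
to the norm on the cone. -/
lemma exists_strictly_positive [FiniteDimensional ℝ V] (C : ProperCone ℝ V)
    (hC : ∀ x ∈ C, -x ∈ C → x = 0) :
    ∃ f ∈ dualSet C, ∃ c > 0, ∀ x ∈ C, c * ‖x‖ ≤ f x := by
  classical
  have hsep : ∀ x ∈ C, x ≠ 0 → ∃ l ∈ dualSet C, 0 < l x := fun x hx hx0 => by
    have hn : -x ∉ C := fun h => hx0 (hC x hx h)
    obtain ⟨l, hl, hlx⟩ := C.hyperplane_separation_point hn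
    exact ⟨l, fun y hy => hl y hy, by simpa using hlx⟩
  let K : Set V := (C : Set V) ∩ Metric.sphere 0 1
  have hK : IsCompact K := (isCompact_sphere 0 1).inter_left C.isClosed
  have hK0 : ∀ x ∈ K, x ≠ 0 := fun x hx => by
    have := hx.2
    rw [mem_sphere_zero_iff_norm] at this
    exact norm_ne_zero_iff.1 (by rw [this]; exact one_ne_zero)
  obtain ⟨t, ht⟩ := hK.elim_finite_subcover
    (fun l : dualSet C => {x : V | 0 < l.1 x})
    (fun l => isOpen_lt continuous_const l.1.continuous)
    (fun x hx => by
      obtain ⟨l, hl, hlx⟩ := hsep x hx.1 (hK0 x hx)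
      exact Set.mem_iUnion.2 ⟨⟨l, hl⟩, hlx⟩)
  let f : V →L[ℝ] ℝ := ∑ l ∈ t, l.1
  have hfx : ∀ x, f x = ∑ l ∈ t, l.1 x := fun x => by simp [f]
  have hf : f ∈ dualSet C := fun x hx => by
    rw [hfx]; exact Finset.sum_nonneg fun l _ => l.2 x hx
  have hpos : ∀ x ∈ K, 0 < f x := fun x hx => by
    obtain ⟨l, hl⟩ := Set.mem_iUnion.1 (ht hx)
    obtain ⟨hlt, hlx⟩ := Set.mem_iUnion.1 hl
    rw [hfx]
    exact Finset.sum_pos' (fun l _ => l.2 x hx.1) ⟨l, hlt, hlx⟩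
  obtain ⟨c, hc, hcK⟩ : ∃ c > 0, ∀ x ∈ K, c ≤ f x := by
    rcases K.eq_empty_or_nonempty with h | h
    · exact ⟨1, one_pos, by simp [h]⟩
    · obtain ⟨x, hx, hmin⟩ := hK.exists_isMinOn h f.continuous.continuousOn
      exact ⟨f x, hpos x hx, fun y hy => hmin hy⟩
  refine ⟨f, hf, c, hc, fun x hx => ?_⟩
  rcases eq_or_ne x 0 with rfl | hx0
  · simp
  have hn : 0 < ‖x‖ := norm_pos_iff.2 hx0
  have := hcK (‖x‖⁻¹ • x) ⟨C.smul_mem hx (by positivity), by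
    rw [mem_sphere_zero_iff_norm, norm_smul, norm_inv, norm_norm, inv_mul_cancel₀ hn.ne']⟩
  rw [map_smul, smul_eq_mul, inv_mul_eq_div, le_div_iff₀ hn] at this
  exact this

/-- On cone preserving maps the operator norm is comparable to the value of a strictly positive
functional on the image of an interior point. -/
lemma exists_norm_le_mul_apply {C : ProperCone ℝ V} {z : V} (hz : z ∈ interior (C : Set V))
    {f : V →L[ℝ] ℝ} {c : ℝ} (hc : 0 < c) (hf : ∀ x ∈ C, c * ‖x‖ ≤ f x) :
    ∃ K > 0, ∀ a ∈ preservers C, ‖a‖ ≤ K * f (a z) := by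
  obtain ⟨ε, hε, hb⟩ := exists_ball_subset hz
  have hzC : z ∈ C := by simpa using hb 0 (by simpa using hε.le)
  refine ⟨3 / (c * ε), by positivity, fun a ha => ?_⟩
  have hfz := hf _ (ha z hzC)
  have hfz0 : 0 ≤ f (a z) := le_trans (by positivity) hfz
  refine ContinuousLinearMap.opNorm_le_bound _ (by positivity) fun v => ?_
  rcases eq_or_ne v 0 with rfl | hv
  · simp
  have hn : 0 < ‖v‖ := norm_pos_iff.2 hv
  set w := (ε / ‖v‖) • v with hw
  have hwn : ‖w‖ ≤ ε := by
    rw [hw, norm_smul, Real.norm_of_nonneg (by positivity), div_mul_cancel₀ _ hn.ne']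
  have h1 := hf _ (ha _ (hb w hwn))
  have h2 := hf _ (ha _ (hb (-w) (by rwa [norm_neg])))
  simp only [map_add, map_neg] at h1 h2
  have h3 : ‖a w‖ ≤ ‖a z + a w‖ + ‖a z‖ := by
    simpa using norm_sub_le (a z + a w) (a z)
  have h4 : c * ‖a w‖ ≤ 3 * f (a z) := by
    have : 0 ≤ c * ‖a z + -a w‖ := by positivity
    nlinarith
  have h5 : ‖a w‖ = ε / ‖v‖ * ‖a v‖ := by
    rw [hw, map_smul, norm_smul, Real.norm_of_nonneg (by positivity)]
  rw [h5] at h4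
  rw [div_mul_eq_mul_div, div_mul_eq_mul_div, le_div_iff₀ (by positivity)]
  have h6 : c * (ε / ‖v‖ * ‖a v‖) * ‖v‖ ≤ 3 * f (a z) * ‖v‖ := by gcongr
  calc ‖a v‖ * (c * ε) = c * (ε / ‖v‖ * ‖a v‖) * ‖v‖ := by field_simp
    _ ≤ _ := h6

lemma exists_enorm_le_mul_ofReal {C : ProperCone ℝ V} {z : V} (hz : z ∈ interior (C : Set V))
    {f : V →L[ℝ] ℝ} {c : ℝ} (hc : 0 < c) (hf : ∀ x ∈ C, c * ‖x‖ ≤ f x) :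
    ∃ K : ℝ≥0∞, K ≠ ∞ ∧ ∀ a ∈ preservers C, ‖a‖ₑ ≤ K * ENNReal.ofReal (f (a z)) := by
  obtain ⟨K, hK, H⟩ := exists_norm_le_mul_apply hz hc hf
  refine ⟨ENNReal.ofReal K, ENNReal.ofReal_ne_top, fun a ha => ?_⟩
  rw [← ofReal_norm, ← ENNReal.ofReal_mul hK.le]
  exact ENNReal.ofReal_le_ofReal (H a ha)

end dual

/-! ### The fixed point equation, tested against functionals in the dual cone -/

section equation

variable {V : Type*} [NormedAddCommGroup V] [InnerProductSpace ℝ V] [FiniteDimensional ℝ V]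
  [MeasurableSpace V]

/-- `E[ψ(⟨l, Z⟩⁺)]` for `Z` of law `ρ`, as a function of the functional `l`. -/
noncomputable def testMoment (ρ : Measure V) (ψ : ℝ≥0∞ → ℝ≥0∞) (l : V →L[ℝ] ℝ) : ℝ≥0∞ :=
  ∫⁻ z, ψ (ENNReal.ofReal (l z)) ∂ρ

variable {C : ProperCone ℝ V} {μ : Measure (V →L[ℝ] V)} [IsProbabilityMeasure μ]
  {ν : Measure ℕ} {ρ : Measure V} [IsProbabilityMeasure ρ]

lemma testMoment_id_eq_ofReal (hρ : IsFixedPoint C ν μ ρ) {l : V →L[ℝ] ℝ} (hl : l ∈ dualSet C) :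
    testMoment ρ id l = ENNReal.ofReal (l (∫ z, z ∂ρ)) := by
  rw [← l.integral_comp_comm hρ.integrable, ofReal_integral_eq_lintegral_ofReal
    (l.integrable_comp hρ.integrable)]
  · rfl
  · filter_upwards [hρ.mem_cone] with z hz using hl z hz

lemma mean_mem (hρ : IsFixedPoint C ν μ ρ) : ∫ z, z ∂ρ ∈ C :=
  C.convex.integral_mem C.isClosed hρ.mem_cone hρ.integrable

variable [BorelSpace V]

lemma measurable_testMoment (ρ : Measure V) [IsProbabilityMeasure ρ] {ψ : ℝ≥0∞ → ℝ≥0∞}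
    (hψ : Measurable ψ) : Measurable (testMoment ρ ψ) := by
  have : Measurable fun q : (V →L[ℝ] ℝ) × V => ψ (ENNReal.ofReal (q.1 q.2)) := by
    have h : Continuous fun q : (V →L[ℝ] ℝ) × V => q.1 q.2 := by fun_prop
    exact hψ.comp (ENNReal.measurable_ofReal.comp h.measurable)
  exact this.lintegral_prod_right'

lemma measurable_testMoment_comp (ρ : Measure V) [IsProbabilityMeasure ρ] {ψ : ℝ≥0∞ → ℝ≥0∞}
    (hψ : Measurable ψ) (l : V →L[ℝ] ℝ) :
    Measurable fun a : V →L[ℝ] V => testMoment ρ ψ (l.comp a) := by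
  exact measurable_comp_left (measurable_testMoment ρ hψ) l

lemma measurable_ofReal_apply_apply (l : V →L[ℝ] ℝ) :
    Measurable fun x : (V →L[ℝ] V) × V => ENNReal.ofReal (l (x.1 x.2)) := by
  have h : Continuous fun x : (V →L[ℝ] V) × V => l (x.1 x.2) := by fun_prop
  exact ENNReal.measurable_ofReal.comp h.measurable

lemma lintegral_prod_eq_testMoment (μ : Measure (V →L[ℝ] V)) [IsProbabilityMeasure μ]
    (ρ : Measure V) [IsProbabilityMeasure ρ] {ψ : ℝ≥0∞ → ℝ≥0∞} (hψ : Measurable ψ)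
    (l : V →L[ℝ] ℝ) :
    ∫⁻ x, ψ (ENNReal.ofReal (l (x.1 x.2))) ∂(μ.prod ρ)
      = ∫⁻ a, testMoment ρ ψ (l.comp a) ∂μ := by
  exact lintegral_prod _ (hψ.comp (measurable_ofReal_apply_apply l)).aemeasurable

lemma testMoment_rpow_le (ρ : Measure V) (l : V →L[ℝ] ℝ) {h : ℝ} (hh : 0 ≤ h) :
    testMoment ρ (fun t => t ^ h) l ≤ ‖l‖ₑ ^ h * ∫⁻ z, ‖z‖ₑ ^ h ∂ρ := by
  rw [← lintegral_const_mul _ (by fun_prop)]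
  refine lintegral_mono fun z => ?_
  dsimp only
  rw [← ENNReal.mul_rpow_of_nonneg _ _ hh]
  exact ENNReal.rpow_le_rpow (ofReal_apply_le l z) hh

lemma ofReal_apply_mean_rpow_le (hρ : IsFixedPoint C ν μ ρ) {l : V →L[ℝ] ℝ} (hl : l ∈ dualSet C)
    {h : ℝ} (hh : 1 ≤ h) :
    ENNReal.ofReal (l (∫ z, z ∂ρ)) ^ h ≤ testMoment ρ (fun t => t ^ h) l := by
  rw [← testMoment_id_eq_ofReal hρ hl]
  have : Measurable fun z => ENNReal.ofReal (l z) := ENNReal.measurable_ofReal.comp l.measurable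
  exact rpow_lintegral_le ρ this.aemeasurable hh

/-- The invariance of the law `ρ` under the smoothing transform, as a scalar identity. -/
lemma testMoment_eq (hμ : ∀ᵐ a ∂μ, a ∈ preservers C) (hρ : IsFixedPoint C ν μ ρ)
    {ψ : ℝ≥0∞ → ℝ≥0∞} (hψ : Measurable ψ) {l : V →L[ℝ] ℝ} (hl : l ∈ dualSet C) :
    testMoment ρ ψ l = ∫⁻ n, ∫⁻ w, ψ (∑ i ∈ Finset.range n, ENNReal.ofReal (l ((w i).1 (w i).2)))
      ∂(Measure.infinitePi fun _ : ℕ => μ.prod ρ) ∂ν := by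
  have hF : Measurable fun z : V => ψ (ENNReal.ofReal (l z)) :=
    hψ.comp (ENNReal.measurable_ofReal.comp l.measurable)
  have hcone : ∀ᵐ x ∂(μ.prod ρ), x.1 x.2 ∈ C := by
    have h1 : ∀ᵐ x ∂(μ.prod ρ), x.1 ∈ preservers C := Measure.quasiMeasurePreserving_fst.ae hμ
    have h2 : ∀ᵐ x ∂(μ.prod ρ), x.2 ∈ C := Measure.quasiMeasurePreserving_snd.ae hρ.mem_cone
    filter_upwards [h1, h2] with x hx1 hx2 using hx1 _ hx2
  have hall : ∀ᵐ w ∂(Measure.infinitePi fun _ : ℕ => μ.prod ρ), ∀ i, (w i).1 (w i).2 ∈ C :=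
    ae_all_iff.2 fun i =>
      (measurePreserving_eval_infinitePi (fun _ : ℕ => μ.prod ρ) i).quasiMeasurePreserving.ae hcone
  rw [testMoment]
  conv_lhs => rw [← hρ.invariant]
  rw [smoothing, lintegral_map hF measurable_randomSum]
  refine (lintegral_prod _ (hF.comp measurable_randomSum).aemeasurable).trans ?_
  refine lintegral_congr fun n => lintegral_congr_ae ?_
  filter_upwards [hall] with w hw
  rw [Function.comp_apply, randomSum, map_sum, ENNReal.ofReal_sum_of_nonneg fun i _ => hl _ (hw i)]

lemma testMoment_id_eq (hμ : ∀ᵐ a ∂μ, a ∈ preservers C) (hρ : IsFixedPoint C ν μ ρ)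
    {l : V →L[ℝ] ℝ} (hl : l ∈ dualSet C) :
    testMoment ρ id l = countMoment ν 1 * ∫⁻ a, testMoment ρ id (l.comp a) ∂μ := by
  rw [testMoment_eq hμ hρ measurable_id hl, ← lintegral_prod_eq_testMoment μ ρ measurable_id,
    countMoment, ← lintegral_mul_const _ (measurable_of_countable _)]
  refine lintegral_congr fun n => ?_
  rw [ENNReal.rpow_one]
  exact lintegral_sum_eval _ (measurable_ofReal_apply_apply l) n

/-- The mean of a fixed point is an interior point of the cone: otherwise the common kernel of the
functionals in the dual cone that vanish at the mean is a proper subspace that meets the cone and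
that the support of `μ` leaves invariant. -/
lemma mean_mem_interior (hC_solid : (interior (C : Set V)).Nonempty)
    (hμ : ∀ᵐ a ∂μ, a ∈ preservers C)
    (hμ_C : ConditionC C (suppSemigroup μ : Set (V →L[ℝ] V)))
    (hν0 : countMoment ν 1 ≠ 0) (hρ : IsFixedPoint C ν μ ρ) :
    ∫ z, z ∂ρ ∈ interior (C : Set V) := by
  set m := ∫ z, z ∂ρ with hm
  by_contra hmC
  let W : Submodule ℝ V :=
    { carrier := {x | ∀ l ∈ dualSet C, l m = 0 → l x = 0}
      add_mem' := fun {x y} hx hy l hl h0 => by rw [map_add, hx l hl h0, hy l hl h0, add_zero]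
      zero_mem' := fun l _ _ => map_zero l
      smul_mem' := fun r x hx l hl h0 => by rw [map_smul, hx l hl h0, smul_zero] }
  have hW : ∀ x, x ∈ W ↔ ∀ l ∈ dualSet C, l m = 0 → l x = 0 := fun _ => Iff.rfl
  let Γ : Subsemigroup (V →L[ℝ] V) :=
    { carrier := {a | ∀ x ∈ W, a x ∈ W}
      mul_mem' := fun {a b} ha hb x hx => ha _ (hb x hx) }
  have hΓclosed : IsClosed (Γ : Set (V →L[ℝ] V)) := by
    have : (Γ : Set (V →L[ℝ] V)) = ⋂ x ∈ W, (fun a : V →L[ℝ] V => a x) ⁻¹' W := by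
      ext a; simp only [Set.mem_iInter]; rfl
    rw [this]
    exact isClosed_biInter fun x _ => W.closed_of_finiteDimensional.preimage (by fun_prop)
  have hsupp : μ.support ⊆ (Γ : Set (V →L[ℝ] V)) := by
    intro a ha x hx
    rw [hW]
    intro l hl h0
    -- `E[l (A m)] = l m / E[N] = 0`, so `l ∘ A` also vanishes at `m`, almost surely.
    have hint : ∫⁻ a, testMoment ρ id (l.comp a) ∂μ = 0 := by
      have := testMoment_id_eq hμ hρ hl
      rw [testMoment_id_eq_ofReal hρ hl, ← hm, h0, ENNReal.ofReal_zero] at this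
      exact (mul_eq_zero.1 this.symm).resolve_left hν0
    rw [lintegral_eq_zero_iff (measurable_testMoment_comp ρ measurable_id l)] at hint
    have hae : ∀ᵐ a ∂μ, l (a x) = 0 := by
      filter_upwards [hint, hμ] with a ha haC
      have hla := comp_mem_dualSet hl haC
      rw [testMoment_id_eq_ofReal hρ hla, Pi.zero_apply, ENNReal.ofReal_eq_zero] at ha
      exact hx _ hla (le_antisymm ha (hla _ (mean_mem hρ)))
    have hcl : IsClosed {a : V →L[ℝ] V | l (a x) = 0} :=
      isClosed_eq (by fun_prop) continuous_const
    exact Measure.support_subset_of_isClosed hcl hae ha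
  have hWtop : W = ⊤ := by
    refine hμ_C.1 W ⟨m, fun l _ h0 => h0, mean_mem hρ, hρ.mean_ne_zero⟩ fun a ha x hx => ?_
    have hle : suppSemigroup μ ≤ Γ := sInf_le ⟨hΓclosed, hsupp⟩
    exact hle ha x hx
  -- A supporting hyperplane at `m` contradicts `W = ⊤`.
  obtain ⟨g, hg⟩ := geometric_hahn_banach_open_point C.convex.interior isOpen_interior hmC
  have hcl : closure (interior (C : Set V)) = C := by
    rw [C.convex.closure_interior_eq_closure_of_nonempty_interior hC_solid,
      C.isClosed.closure_eq]
  have hle : ∀ x ∈ C, g x ≤ g m := fun x hx => by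
    have hx' : x ∈ closure (interior (C : Set V)) := by rw [hcl]; exact hx
    exact closure_minimal (fun y hy => (hg y hy).le)
      (isClosed_le g.continuous continuous_const) hx'
  have hgC : ∀ x ∈ C, g x ≤ 0 := fun x hx => by
    by_contra! hpos
    -- Scaling `x` makes `g` exceed any bound on the cone.
    have := hle _ (C.smul_mem hx (r := |g m| / g x + 1) (by positivity))
    rw [map_smul, smul_eq_mul, add_mul, div_mul_cancel₀ _ hpos.ne', one_mul] at this
    linarith [le_abs_self (g m)]
  have hgm : g m = 0 :=
    le_antisymm (hgC m (mean_mem hρ)) (by simpa using hle 0 C.zero_mem)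
  obtain ⟨y, hy⟩ := hC_solid
  have hyW : y ∈ W := by rw [hWtop]; trivial
  have := hyW (-g) (fun x hx => by simpa using hgC x hx) (by simpa using hgm)
  have h2 := hg y hy
  rw [hgm] at h2
  simp only [neg_apply, neg_eq_zero] at this
  linarith

end equation

/-! ### Iteration along products -/

section iterate

variable {V : Type*} [NormedAddCommGroup V] [InnerProductSpace ℝ V] [FiniteDimensional ℝ V]
  {C : ProperCone ℝ V} {μ : Measure (V →L[ℝ] V)} [IsProbabilityMeasure μ]

lemma lintegral_comp_powLaw_succ {G : (V →L[ℝ] ℝ) → ℝ≥0∞} (hG : Measurable G) (f : V →L[ℝ] ℝ)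
    (n : ℕ) :
    ∫⁻ b, G (f.comp b) ∂(powLaw μ (n + 1))
      = ∫⁻ b, ∫⁻ a, G ((f.comp b).comp a) ∂μ ∂(powLaw μ n) :=
  lintegral_powLaw_succ μ (measurable_comp_left hG f) n

/-- Iteration of a one-step contraction by the factor `r`. -/
lemma pow_mul_lintegral_powLaw_le (hμ : ∀ᵐ a ∂μ, a ∈ preservers C)
    {G : (V →L[ℝ] ℝ) → ℝ≥0∞} (hG : Measurable G) {m r : ℝ≥0∞}
    (H : ∀ l ∈ dualSet C, m * ∫⁻ a, G (l.comp a) ∂μ ≤ r * G l)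
    {f : V →L[ℝ] ℝ} (hf : f ∈ dualSet C) (n : ℕ) :
    m ^ n * ∫⁻ b, G (f.comp b) ∂(powLaw μ n) ≤ r ^ n * G f := by
  induction n with
  | zero =>
    rw [powLaw_zero, lintegral_dirac' _ (measurable_comp_left hG f), pow_zero, pow_zero]
    exact le_rfl
  | succ n ih =>
    calc m ^ (n + 1) * ∫⁻ b, G (f.comp b) ∂(powLaw μ (n + 1))
        = m ^ n * (m * ∫⁻ b, ∫⁻ a, G ((f.comp b).comp a) ∂μ ∂(powLaw μ n)) := by
          rw [lintegral_comp_powLaw_succ hG, pow_succ, mul_assoc]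
      _ ≤ m ^ n * ∫⁻ b, m * ∫⁻ a, G ((f.comp b).comp a) ∂μ ∂(powLaw μ n) := by
          gcongr
          exact lintegral_const_mul_le _ _
      _ ≤ m ^ n * ∫⁻ b, r * G (f.comp b) ∂(powLaw μ n) := by
          gcongr m ^ n * ?_
          refine lintegral_mono_ae ?_
          filter_upwards [ae_powLaw_mem_preservers μ hμ n] with b hb
          exact H _ (comp_mem_dualSet hf hb)
      _ = r * (m ^ n * ∫⁻ b, G (f.comp b) ∂(powLaw μ n)) := by
          rw [lintegral_const_mul _ (measurable_comp_left hG f), mul_left_comm]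
      _ ≤ r * (r ^ n * G f) := by gcongr
      _ = r ^ (n + 1) * G f := by rw [pow_succ, mul_left_comm, mul_assoc]

/-- Iteration of a one-step upper bound with an error term `R`. -/
lemma le_pow_mul_lintegral_powLaw_add (hμ : ∀ᵐ a ∂μ, a ∈ preservers C)
    {G R : (V →L[ℝ] ℝ) → ℝ≥0∞} (hG : Measurable G) (hR : Measurable R) {m : ℝ≥0∞}
    (H : ∀ l ∈ dualSet C, G l ≤ m * ∫⁻ a, G (l.comp a) ∂μ + R l)
    {f : V →L[ℝ] ℝ} (hf : f ∈ dualSet C) (n : ℕ) :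
    G f ≤ m ^ n * ∫⁻ b, G (f.comp b) ∂(powLaw μ n)
      + ∑ k ∈ Finset.range n, m ^ k * ∫⁻ b, R (f.comp b) ∂(powLaw μ k) := by
  induction n with
  | zero =>
    rw [powLaw_zero, lintegral_dirac' _ (measurable_comp_left hG f), pow_zero, one_mul,
      Finset.sum_range_zero, add_zero]
    exact le_rfl
  | succ n ih =>
    refine ih.trans ?_
    rw [Finset.sum_range_succ, add_comm (∑ k ∈ Finset.range n, _), ← add_assoc]
    gcongr
    calc m ^ n * ∫⁻ b, G (f.comp b) ∂(powLaw μ n)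
        ≤ m ^ n * ∫⁻ b, (m * ∫⁻ a, G ((f.comp b).comp a) ∂μ + R (f.comp b)) ∂(powLaw μ n) := by
          gcongr m ^ n * ?_
          refine lintegral_mono_ae ?_
          filter_upwards [ae_powLaw_mem_preservers μ hμ n] with b hb
          exact H _ (comp_mem_dualSet hf hb)
      _ = m ^ (n + 1) * ∫⁻ b, G (f.comp b) ∂(powLaw μ (n + 1))
          + m ^ n * ∫⁻ b, R (f.comp b) ∂(powLaw μ n) := by
          have hin : Measurable fun b : V →L[ℝ] V => ∫⁻ a, G ((f.comp b).comp a) ∂μ := by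
            have h : Continuous fun q : (V →L[ℝ] V) × (V →L[ℝ] V) =>
              (f.comp q.1).comp q.2 := by fun_prop
            exact (hG.comp h.measurable).lintegral_prod_right'
          rw [lintegral_add_right _ (measurable_comp_left hR f), lintegral_const_mul _ hin,
            lintegral_comp_powLaw_succ hG, pow_succ, mul_add, mul_assoc]

end iterate

/-! ### Geometric decay of the moments of products -/

section decay

variable {V : Type*} [NormedAddCommGroup V] [InnerProductSpace ℝ V]

/-- `m ^ n E[|Aₙ ⋯ A₁| ^ s]` is at most `D r ^ n` for some finite `D` and some `r < 1`. When the
moments are finite and `0 < m < ∞`, this says that `κ(s) < 1 / m`. -/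
def GeometricDecay (μ : Measure (V →L[ℝ] V)) [IsProbabilityMeasure μ] (m : ℝ≥0∞) (s : ℝ) : Prop :=
  ∃ D : ℝ≥0∞, D ≠ ∞ ∧ ∃ r < 1, ∀ n, m ^ n * prodMoment μ s n ≤ D * r ^ n

variable {μ : Measure (V →L[ℝ] V)} [IsProbabilityMeasure μ]

lemma GeometricDecay.kappa_lt {m : ℝ≥0∞} (hm0 : m ≠ 0) (hm : m ≠ ∞) {s : ℝ}
    (H : GeometricDecay μ m s) : kappa μ s < m⁻¹ := by
  obtain ⟨D, hD, r₀, hr₀, H⟩ := H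
  -- Enlarge the ratio, so that it is positive and so that the constant `D` can be absorbed.
  obtain ⟨r, hr, hr1⟩ := exists_between hr₀
  obtain ⟨q, hq, hq1⟩ := exists_between hr1
  have hr0 : r ≠ 0 := hr.ne_bot
  have hrt : r ≠ ∞ := hr1.ne_top
  have hy : 1 < q / r := by
    rw [ENNReal.lt_div_iff_mul_lt (Or.inl hr0) (Or.inl hrt), one_mul]; exact hq
  have hle : kappa μ s ≤ q * m⁻¹ := by
    refine limsup_le_of_le (by isBoundedDefault) ?_
    filter_upwards [ENNReal.eventually_pow_one_div_le hD hy, eventually_gt_atTop 0] with n hn hn0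
    have hn' : (0 : ℝ) < n := by exact_mod_cast hn0
    have hmn : m ^ n * (m⁻¹) ^ n = 1 := by
      rw [← mul_pow, ENNReal.mul_inv_cancel hm0 hm, one_pow]
    have h1 : prodMoment μ s n ≤ D * (r * m⁻¹) ^ n := by
      calc prodMoment μ s n = (m ^ n * (m⁻¹) ^ n) * prodMoment μ s n := by rw [hmn, one_mul]
        _ = (m⁻¹) ^ n * (m ^ n * prodMoment μ s n) := by ring
        _ ≤ (m⁻¹) ^ n * (D * r₀ ^ n) := mul_le_mul_right (H n) _
        _ ≤ (m⁻¹) ^ n * (D * r ^ n) := by gcongr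
        _ = _ := by rw [mul_pow]; ring
    calc prodMoment μ s n ^ (1 / (n : ℝ)) ≤ (D * (r * m⁻¹) ^ n) ^ (1 / (n : ℝ)) := by gcongr
      _ = D ^ (1 / (n : ℝ)) * (r * m⁻¹) := by
          rw [ENNReal.mul_rpow_of_nonneg _ _ (by positivity), ← ENNReal.rpow_natCast,
            ← ENNReal.rpow_mul, mul_one_div_cancel hn'.ne', ENNReal.rpow_one]
      _ ≤ q / r * (r * m⁻¹) := by gcongr
      _ = q * m⁻¹ := by rw [← mul_assoc, ENNReal.div_mul_cancel hr0 hrt]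
  refine hle.trans_lt ?_
  have hmi0 : m⁻¹ ≠ 0 := ENNReal.inv_ne_zero.2 hm
  have hmit : m⁻¹ ≠ ∞ := ENNReal.inv_ne_top.2 hm0
  calc q * m⁻¹ < 1 * m⁻¹ := (ENNReal.mul_lt_mul_iff_left hmi0 hmit).2 hq1
    _ = m⁻¹ := one_mul _

lemma geometricDecay_of_kappa_lt {m : ℝ≥0∞} (hm0 : m ≠ 0) (hm : m ≠ ∞) {s : ℝ}
    (hfin : ∀ n, prodMoment μ s n ≠ ∞) (H : kappa μ s < m⁻¹) : GeometricDecay μ m s := by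
  obtain ⟨q, hq, hq1⟩ := exists_between H
  have hq0 : q ≠ 0 := hq.ne_bot
  have hqt : q ≠ ∞ := hq1.ne_top
  have hr : m * q < 1 := by
    rw [← ENNReal.mul_inv_cancel hm0 hm]
    exact (ENNReal.mul_lt_mul_iff_right hm0 hm).2 hq1
  have hr0 : m * q ≠ 0 := mul_ne_zero hm0 hq0
  have hrt : m * q ≠ ∞ := hr.ne_top
  obtain ⟨N, hN⟩ := eventually_atTop.1 ((eventually_lt_of_limsup_lt hq).and (eventually_gt_atTop 0))
  -- Before `N` the bound holds by the choice of the constant.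
  let u : ℕ → ℝ≥0∞ := fun n => m ^ n * prodMoment μ s n / (m * q) ^ n
  have hut : ∀ n, u n ≠ ∞ := fun n => ENNReal.div_ne_top
    (ENNReal.mul_ne_top (ENNReal.pow_ne_top hm) (hfin n)) (pow_ne_zero _ hr0)
  refine ⟨1 + ∑ n ∈ Finset.range N, u n, ENNReal.add_ne_top.2 ⟨ENNReal.one_ne_top,
    ENNReal.sum_ne_top.2 fun n _ => hut n⟩, m * q, hr, fun n => ?_⟩
  rcases lt_or_ge n N with hn | hn
  · calc m ^ n * prodMoment μ s n = u n * (m * q) ^ n :=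
          (ENNReal.div_mul_cancel (pow_ne_zero _ hr0) (ENNReal.pow_ne_top hrt)).symm
      _ ≤ _ := by
          gcongr
          exact (Finset.single_le_sum (f := u) (fun _ _ => zero_le)
            (Finset.mem_range.2 hn)).trans le_add_self
  · obtain ⟨h1, h2⟩ := hN n hn
    have hn' : (0 : ℝ) < n := by exact_mod_cast h2
    have h3 : prodMoment μ s n ≤ q ^ n := by
      calc prodMoment μ s n = (prodMoment μ s n ^ (1 / (n : ℝ))) ^ n := by
            rw [← ENNReal.rpow_natCast, ← ENNReal.rpow_mul, one_div_mul_cancel hn'.ne',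
              ENNReal.rpow_one]
        _ ≤ q ^ n := by gcongr
    calc m ^ n * prodMoment μ s n ≤ m ^ n * q ^ n := by gcongr
      _ = 1 * (m * q) ^ n := by rw [one_mul, mul_pow]
      _ ≤ _ := by gcongr; exact le_self_add

/-- Log-convexity of the moments: decay at `h` and boundedness at `1` give decay in between. -/
lemma GeometricDecay.interpolate [FiniteDimensional ℝ V] {m K : ℝ≥0∞} (hK : K ≠ ∞)
    (h1 : ∀ n, m ^ n * prodMoment μ 1 n ≤ K) {h q : ℝ} (hq1 : 1 < q) (hqh : q ≤ h)
    (H : GeometricDecay μ m h) : GeometricDecay μ m q := by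
  obtain ⟨D, hD, r, hr, H⟩ := H
  set θ := (h - q) / (h - 1) with hθ
  have hh : 0 < h - 1 := by linarith
  have hθ0 : 0 ≤ θ := div_nonneg (by linarith) hh.le
  have hθ1 : θ < 1 := by rw [hθ, div_lt_one hh]; linarith
  have hθq : θ + (1 - θ) * h = q := by rw [hθ]; field_simp; ring
  refine ⟨K ^ θ * D ^ (1 - θ), by finiteness, r ^ (1 - θ),
    ENNReal.rpow_lt_one hr (by linarith), fun n => ?_⟩
  have hint := lintegral_rpow_interpolate (powLaw μ n) (f := fun a => ‖a‖ₑ) (by fun_prop)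
    (show 0 ≤ h by linarith) hθ0 hθ1.le
  have h1n := h1 n
  have hhn := H n
  simp only [prodMoment_eq, ENNReal.rpow_one] at h1n hhn ⊢
  rw [hθq] at hint
  have hsplit : m ^ n = (m ^ n) ^ θ * (m ^ n) ^ (1 - θ) := by
    rw [← ENNReal.rpow_add_of_nonneg _ _ hθ0 (by linarith), add_sub_cancel, ENNReal.rpow_one]
  calc m ^ n * ∫⁻ a, ‖a‖ₑ ^ q ∂(powLaw μ n)
      ≤ (m ^ n) ^ θ * (m ^ n) ^ (1 - θ) * ((∫⁻ a, ‖a‖ₑ ∂(powLaw μ n)) ^ θ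
          * (∫⁻ a, ‖a‖ₑ ^ h ∂(powLaw μ n)) ^ (1 - θ)) := by
        rw [← hsplit]; gcongr
    _ = (m ^ n * ∫⁻ a, ‖a‖ₑ ∂(powLaw μ n)) ^ θ
          * (m ^ n * ∫⁻ a, ‖a‖ₑ ^ h ∂(powLaw μ n)) ^ (1 - θ) := by
        rw [ENNReal.mul_rpow_of_nonneg _ _ hθ0, ENNReal.mul_rpow_of_nonneg _ _ (by linarith)]
        ring
    _ ≤ K ^ θ * (D * r ^ n) ^ (1 - θ) := by
        gcongr
    _ = K ^ θ * D ^ (1 - θ) * (r ^ (1 - θ)) ^ n := by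
        rw [ENNReal.mul_rpow_of_nonneg _ _ (by linarith), ← ENNReal.rpow_natCast,
          ← ENNReal.rpow_natCast, ← ENNReal.rpow_mul, ← ENNReal.rpow_mul, mul_comm (n : ℝ),
          mul_assoc]

end decay

/-! ### From finite moments to decay -/

section necessity

variable {V : Type*} [NormedAddCommGroup V] [InnerProductSpace ℝ V] [FiniteDimensional ℝ V]
  [MeasurableSpace V] [BorelSpace V]
  {C : ProperCone ℝ V} {μ : Measure (V →L[ℝ] V)} [IsProbabilityMeasure μ]
  {ν : Measure ℕ} {ρ : Measure V} [IsProbabilityMeasure ρ]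

/-- Since the mean of a fixed point is preserved, `E[N] ^ n E|Aₙ ⋯ A₁|` stays bounded. -/
lemma exists_pow_mul_prodMoment_one_le (hμ : ∀ᵐ a ∂μ, a ∈ preservers C)
    (hρ : IsFixedPoint C ν μ ρ) (hz : ∫ z, z ∂ρ ∈ interior (C : Set V))
    {f : V →L[ℝ] ℝ} (hfC : f ∈ dualSet C) {c : ℝ} (hc : 0 < c) (hf : ∀ x ∈ C, c * ‖x‖ ≤ f x) :
    ∃ K : ℝ≥0∞, K ≠ ∞ ∧ ∀ n, countMoment ν 1 ^ n * prodMoment μ 1 n ≤ K := by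
  obtain ⟨K, hK, HK⟩ := exists_enorm_le_mul_ofReal hz hc hf
  have hG := measurable_testMoment ρ measurable_id
  refine ⟨K * testMoment ρ id f, ENNReal.mul_ne_top hK ?_, fun n => ?_⟩
  · rw [testMoment_id_eq_ofReal hρ hfC]; exact ENNReal.ofReal_ne_top
  have hit := pow_mul_lintegral_powLaw_le hμ hG (m := countMoment ν 1) (r := 1)
    (fun l hl => by rw [one_mul]; exact (testMoment_id_eq hμ hρ hl).ge) hfC n
  rw [one_pow, one_mul] at hit
  simp only [prodMoment_eq, ENNReal.rpow_one]
  calc countMoment ν 1 ^ n * ∫⁻ a, ‖a‖ₑ ∂(powLaw μ n)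
      ≤ countMoment ν 1 ^ n * ∫⁻ a, K * testMoment ρ id (f.comp a) ∂(powLaw μ n) := by
        gcongr countMoment ν 1 ^ n * ?_
        refine lintegral_mono_ae ?_
        filter_upwards [ae_powLaw_mem_preservers μ hμ n] with a ha
        rw [testMoment_id_eq_ofReal hρ (comp_mem_dualSet hfC ha)]
        exact HK a ha
    _ = K * (countMoment ν 1 ^ n * ∫⁻ a, testMoment ρ id (f.comp a) ∂(powLaw μ n)) := by
        rw [lintegral_const_mul _ (measurable_comp_left hG f), mul_left_comm]
    _ ≤ _ := by gcongr

lemma lintegral_prod_enorm_rpow_le (μ : Measure (V →L[ℝ] V)) [IsProbabilityMeasure μ]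
    (ρ : Measure V) [IsProbabilityMeasure ρ] {p : ℝ} (hp : 0 ≤ p) :
    ∫⁻ x, ‖x.1 x.2‖ₑ ^ p ∂(μ.prod ρ) ≤ normMoment μ p * ∫⁻ z, ‖z‖ₑ ^ p ∂ρ := by
  rw [normMoment, ← lintegral_prod_mul (by fun_prop) (by fun_prop)]
  refine lintegral_mono fun x => ?_
  dsimp only
  rw [← ENNReal.mul_rpow_of_nonneg _ _ hp]
  exact ENNReal.rpow_le_rpow (x.1.le_opENorm x.2) hp

/-- Uniformly in the direction of `l`, the variable `⟨l, A Z⟩` has a chance to be of the order of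
`|l|`: its mean is of that order, and it is dominated by `|l|` times an integrable variable. -/
lemma exists_le_measure_lt (hμ : ∀ᵐ a ∂μ, a ∈ preservers C) (hμ1 : normMoment μ 1 ≠ ∞)
    (hm0 : countMoment ν 1 ≠ 0) (hm : countMoment ν 1 ≠ ∞)
    (hρ : IsFixedPoint C ν μ ρ) (hz : ∫ z, z ∂ρ ∈ interior (C : Set V)) :
    ∃ a : ℝ≥0∞, a ≠ 0 ∧ ∃ δ : ℝ≥0∞, δ ≠ 0 ∧ ∀ l ∈ dualSet C, l ≠ 0 →
      δ ≤ μ.prod ρ {x | a * ‖l‖ₑ < ENNReal.ofReal (l (x.1 x.2))} := by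
  obtain ⟨ε, hε, Hε⟩ := exists_mul_norm_le_apply hz
  -- The mean of `⟨l, A Z⟩` is `⟨l, E Z⟩ / E[N]`, hence at least `b |l|`.
  set b := ENNReal.ofReal ε / countMoment ν 1 with hb
  have hb0 : b ≠ 0 := (ENNReal.div_pos (ENNReal.ofReal_pos.2 hε).ne' hm).ne'
  have hbt : b ≠ ∞ := ENNReal.div_ne_top ENNReal.ofReal_ne_top hm0
  have hb2 : b / 2 ≠ 0 := (ENNReal.half_pos hb0).ne'
  have hgm : Measurable fun x : (V →L[ℝ] V) × V => ‖x.1 x.2‖ₑ := by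
    have h : Continuous fun x : (V →L[ℝ] V) × V => x.1 x.2 := by fun_prop
    exact h.measurable.enorm
  have hg : ∫⁻ x, ‖x.1 x.2‖ₑ ∂(μ.prod ρ) ≠ ∞ := by
    have h1 := lintegral_prod_enorm_rpow_le μ ρ zero_le_one
    simp only [ENNReal.rpow_one] at h1
    exact ne_top_of_le_ne_top (ENNReal.mul_ne_top hμ1 hρ.integrable.2.ne) h1
  obtain ⟨δ, hδ, Hδ⟩ := exists_pos_setLIntegral_lt_of_measure_lt hg hb2
  refine ⟨b / 2, hb2, δ, hδ.ne', fun l hl hl0 => ?_⟩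
  by_contra! hlt
  set s := {x : (V →L[ℝ] V) × V | b / 2 * ‖l‖ₑ < ENNReal.ofReal (l (x.1 x.2))} with hs
  have hsm : MeasurableSet s := measurableSet_lt measurable_const (measurable_ofReal_apply_apply l)
  have hl0' : ‖l‖ₑ ≠ 0 := by
    rw [← ofReal_norm]
    exact (ENNReal.ofReal_pos.2 (norm_pos_iff.2 hl0)).ne'
  have hlow : b * ‖l‖ₑ ≤ ∫⁻ x, ENNReal.ofReal (l (x.1 x.2)) ∂(μ.prod ρ) := by
    have h1 := testMoment_id_eq hμ hρ hl
    rw [← lintegral_prod_eq_testMoment μ ρ measurable_id, testMoment_id_eq_ofReal hρ hl] at h1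
    rw [hb, ENNReal.div_eq_inv_mul, mul_assoc, ← ENNReal.div_eq_inv_mul]
    refine ENNReal.div_le_of_le_mul' (le_trans ?_ h1.le)
    rw [← ofReal_norm, ← ENNReal.ofReal_mul hε.le]
    exact ENNReal.ofReal_le_ofReal (Hε l hl)
  have hup : ∫⁻ x, ENNReal.ofReal (l (x.1 x.2)) ∂(μ.prod ρ)
      ≤ b / 2 * ‖l‖ₑ + ‖l‖ₑ * ∫⁻ x in s, ‖x.1 x.2‖ₑ ∂(μ.prod ρ) := by
    calc ∫⁻ x, ENNReal.ofReal (l (x.1 x.2)) ∂(μ.prod ρ)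
        ≤ ∫⁻ x, (b / 2 * ‖l‖ₑ + ‖l‖ₑ * s.indicator (fun x => ‖x.1 x.2‖ₑ) x) ∂(μ.prod ρ) := by
          refine lintegral_mono fun x => ?_
          by_cases hx : x ∈ s
          · rw [Set.indicator_of_mem hx]
            exact (ofReal_apply_le l _).trans le_add_self
          · exact (not_lt.1 hx).trans le_self_add
      _ = _ := by
          rw [lintegral_add_left measurable_const, lintegral_const, measure_univ, mul_one,
            lintegral_const_mul _ (hgm.indicator hsm), lintegral_indicator hsm]
  refine absurd (hlow.trans hup) (not_le.2 ?_)
  calc b / 2 * ‖l‖ₑ + ‖l‖ₑ * ∫⁻ x in s, ‖x.1 x.2‖ₑ ∂(μ.prod ρ)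
      < b / 2 * ‖l‖ₑ + ‖l‖ₑ * (b / 2) := by
        refine ENNReal.add_lt_add_left (by finiteness) ?_
        exact (ENNReal.mul_lt_mul_iff_right hl0' enorm_ne_top).2 (Hδ s hlt)
    _ = b * ‖l‖ₑ := by rw [mul_comm ‖l‖ₑ, ← add_mul, ENNReal.add_halves]

/-- Strict superadditivity of `t ↦ t ^ h`: as at least two terms of the random sum contribute, the
`h`-th moment exceeds the sum of the moments of the terms by a multiple of `|l| ^ h`. -/
lemma exists_mul_lintegral_add_le_testMoment [IsProbabilityMeasure ν]
    (hμ : ∀ᵐ a ∂μ, a ∈ preservers C)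
    (hμ1 : normMoment μ 1 ≠ ∞) (hν_two : ∀ᵐ n ∂ν, 2 ≤ n)
    (hm0 : countMoment ν 1 ≠ 0) (hm : countMoment ν 1 ≠ ∞)
    (hρ : IsFixedPoint C ν μ ρ) (hz : ∫ z, z ∂ρ ∈ interior (C : Set V)) {h : ℝ} (hh : 1 < h) :
    ∃ c : ℝ≥0∞, c ≠ 0 ∧ ∀ l ∈ dualSet C,
      countMoment ν 1 * ∫⁻ a, testMoment ρ (fun t => t ^ h) (l.comp a) ∂μ + c * ‖l‖ₑ ^ h
        ≤ testMoment ρ (fun t => t ^ h) l := by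
  obtain ⟨a, ha, δ, hδ, H⟩ := exists_le_measure_lt hμ hμ1 hm0 hm hρ hz
  have h2 : (2 : ℝ≥0∞) ^ (h - 1) - 1 ≠ 0 := by
    rw [Ne, tsub_eq_zero_iff_le, not_le]
    exact ENNReal.one_lt_rpow (by norm_num) (by linarith)
  have ha' : a ^ h ≠ 0 := by
    rw [Ne, ENNReal.rpow_eq_zero_iff_of_pos (by linarith)]; exact ha
  refine ⟨(2 ^ (h - 1) - 1) * (a ^ h * δ ^ 2), mul_ne_zero h2 (mul_ne_zero ha' (pow_ne_zero _ hδ)),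
    fun l hl => ?_⟩
  have hψ : Measurable fun t : ℝ≥0∞ => t ^ h := by fun_prop
  rw [testMoment_eq hμ hρ hψ hl, ← lintegral_prod_eq_testMoment μ ρ hψ]
  set U : (V →L[ℝ] V) × V → ℝ≥0∞ := fun x => ENNReal.ofReal (l (x.1 x.2)) with hU
  have hUm : Measurable U := measurable_ofReal_apply_apply l
  have hgain : a ^ h * δ ^ 2 * ‖l‖ₑ ^ h
      ≤ (a * ‖l‖ₑ) ^ h * μ.prod ρ {x | a * ‖l‖ₑ < U x} ^ 2 := by
    rcases eq_or_ne l 0 with hl0 | hl0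
    · have : ‖l‖ₑ = 0 := by rw [hl0, ← ofReal_norm, norm_zero, ENNReal.ofReal_zero]
      rw [this, ENNReal.zero_rpow_of_pos (by linarith), mul_zero]
      exact zero_le
    · rw [ENNReal.mul_rpow_of_nonneg _ _ (by linarith), mul_right_comm]
      gcongr
      exact H l hl hl0
  calc countMoment ν 1 * ∫⁻ x, U x ^ h ∂(μ.prod ρ) + (2 ^ (h - 1) - 1) * (a ^ h * δ ^ 2) * ‖l‖ₑ ^ h
      ≤ countMoment ν 1 * ∫⁻ x, U x ^ h ∂(μ.prod ρ) + (2 ^ (h - 1) - 1) *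
        ((a * ‖l‖ₑ) ^ h * μ.prod ρ {x | a * ‖l‖ₑ < U x} ^ 2) := by
        rw [mul_assoc]; gcongr
    _ = ∫⁻ n : ℕ, ((n : ℝ≥0∞) * ∫⁻ x, U x ^ h ∂(μ.prod ρ) + (2 ^ (h - 1) - 1) *
        ((a * ‖l‖ₑ) ^ h * μ.prod ρ {x | a * ‖l‖ₑ < U x} ^ 2)) ∂ν := by
        rw [lintegral_add_right _ measurable_const, lintegral_const, measure_univ, mul_one,
          lintegral_mul_const _ (measurable_of_countable _), countMoment]
        simp only [ENNReal.rpow_one]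
    _ ≤ _ := by
        refine lintegral_mono_ae ?_
        filter_upwards [hν_two] with n hn
        exact lintegral_sum_rpow_ge (μ.prod ρ) hUm hh.le (a * ‖l‖ₑ) hn

/-- A fixed point with a finite `h`-th moment forces `κ(h) < 1 / E[N]`: the gain from strict
superadditivity makes `E⟨l, Z⟩ ^ h` contract by a fixed factor along the products. -/
lemma geometricDecay_of_moment [IsProbabilityMeasure ν]
    (hμ : ∀ᵐ a ∂μ, a ∈ preservers C)
    (hμ1 : normMoment μ 1 ≠ ∞) (hν_two : ∀ᵐ n ∂ν, 2 ≤ n)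
    (hm0 : countMoment ν 1 ≠ 0) (hm : countMoment ν 1 ≠ ∞)
    (hρ : IsFixedPoint C ν μ ρ) (hz : ∫ z, z ∂ρ ∈ interior (C : Set V))
    {f : V →L[ℝ] ℝ} (hfC : f ∈ dualSet C) {c : ℝ} (hc : 0 < c) (hf : ∀ x ∈ C, c * ‖x‖ ≤ f x)
    {h : ℝ} (hh : 1 < h) (hfin : ∫⁻ z, ‖z‖ₑ ^ h ∂ρ < ∞) :
    GeometricDecay μ (countMoment ν 1) h := by
  obtain ⟨K, hK, HK⟩ := exists_enorm_le_mul_ofReal hz hc hf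
  obtain ⟨γ, hγ, H⟩ := exists_mul_lintegral_add_le_testMoment hμ hμ1 hν_two hm0 hm hρ hz hh
  have hh0 : 0 ≤ h := by linarith
  have hψ : Measurable fun t : ℝ≥0∞ => t ^ h := by fun_prop
  have hG := measurable_testMoment ρ hψ
  set J := testMoment ρ (fun t => t ^ h) with hJ
  set M := ∫⁻ z, ‖z‖ₑ ^ h ∂ρ with hM
  -- The contraction factor is `1 - γ / (M + 1)`; the summand `1` avoids a division by zero.
  have hM1 : M + 1 ≠ ∞ := ENNReal.add_ne_top.2 ⟨hfin.ne, ENNReal.one_ne_top⟩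
  have hM0 : M + 1 ≠ 0 := by simp
  have hJle : ∀ l, J l ≤ ‖l‖ₑ ^ h * M := fun l => testMoment_rpow_le ρ l hh0
  have hJt : ∀ l, J l ≠ ∞ := fun l =>
    ne_top_of_le_ne_top (ENNReal.mul_ne_top (by finiteness) hfin.ne) (hJle l)
  have hcontr : ∀ l ∈ dualSet C,
      countMoment ν 1 * ∫⁻ a, J (l.comp a) ∂μ ≤ (1 - γ / (M + 1)) * J l := by
    intro l hl
    have h1 : γ / (M + 1) * J l ≤ γ * ‖l‖ₑ ^ h := by
      calc γ / (M + 1) * J l ≤ γ / (M + 1) * (‖l‖ₑ ^ h * (M + 1)) := by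
            gcongr
            exact (hJle l).trans (by gcongr; exact le_self_add)
        _ = γ * ‖l‖ₑ ^ h := by
            rw [mul_left_comm, mul_comm, ENNReal.div_mul_cancel hM0 hM1]
    have h2 : γ / (M + 1) * J l ≠ ∞ :=
      ne_top_of_le_ne_top (hJt l) (h1.trans (le_add_self.trans (H l hl)))
    rw [ENNReal.sub_mul fun _ _ => hJt l, one_mul]
    exact ENNReal.le_sub_of_add_le_right h2 ((add_le_add_right h1 _).trans (H l hl))
  refine ⟨K ^ h * J f, ENNReal.mul_ne_top (by finiteness) (hJt f), 1 - γ / (M + 1),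
    ENNReal.sub_lt_self ENNReal.one_ne_top one_ne_zero (ENNReal.div_pos hγ hM1).ne', fun n => ?_⟩
  have hit := pow_mul_lintegral_powLaw_le hμ hG hcontr hfC n
  rw [prodMoment_eq]
  calc countMoment ν 1 ^ n * ∫⁻ a, ‖a‖ₑ ^ h ∂(powLaw μ n)
      ≤ countMoment ν 1 ^ n * ∫⁻ a, K ^ h * J (f.comp a) ∂(powLaw μ n) := by
        gcongr countMoment ν 1 ^ n * ?_
        refine lintegral_mono_ae ?_
        filter_upwards [ae_powLaw_mem_preservers μ hμ n] with a ha
        calc ‖a‖ₑ ^ h ≤ (K * ENNReal.ofReal (f (a (∫ z, z ∂ρ)))) ^ h := by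
              gcongr; exact HK a ha
          _ ≤ _ := by
              rw [ENNReal.mul_rpow_of_nonneg _ _ hh0]
              gcongr
              exact ofReal_apply_mean_rpow_le hρ (comp_mem_dualSet hfC ha) hh.le
    _ = K ^ h * (countMoment ν 1 ^ n * ∫⁻ a, J (f.comp a) ∂(powLaw μ n)) := by
        rw [lintegral_const_mul _ (measurable_comp_left hG f), mul_left_comm]
    _ ≤ K ^ h * ((1 - γ / (M + 1)) ^ n * J f) := by gcongr
    _ = _ := by ring

/-- By Jensen's inequality conditionally on `N`, a finite `h`-th moment of `Z` gives one of `N`. -/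
lemma countMoment_lt_top_of_moment (hμ : ∀ᵐ a ∂μ, a ∈ preservers C)
    (hρ : IsFixedPoint C ν μ ρ) (hz : ∫ z, z ∂ρ ∈ interior (C : Set V))
    {f : V →L[ℝ] ℝ} (hfC : f ∈ dualSet C) (hf0 : f ≠ 0)
    {h : ℝ} (hh : 1 < h) (hfin : ∫⁻ z, ‖z‖ₑ ^ h ∂ρ < ∞) : countMoment ν h < ∞ := by
  have hh0 : 0 ≤ h := by linarith
  have hψ : Measurable fun t : ℝ≥0∞ => t ^ h := by fun_prop
  set e := ∫⁻ x, ENNReal.ofReal (f (x.1 x.2)) ∂(μ.prod ρ) with he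
  have hUm := measurable_ofReal_apply_apply f
  have he0 : e ≠ 0 := by
    intro h0
    obtain ⟨ε, hε, Hε⟩ := exists_mul_norm_le_apply hz
    have h1 := testMoment_id_eq hμ hρ hfC
    rw [← lintegral_prod_eq_testMoment μ ρ measurable_id, testMoment_id_eq_ofReal hρ hfC] at h1
    simp only [id, ← he, h0, mul_zero, ENNReal.ofReal_eq_zero] at h1
    have := Hε f hfC
    have : 0 < ε * ‖f‖ := mul_pos hε (norm_pos_iff.2 hf0)
    linarith
  have hle : countMoment ν h * e ^ h ≤ testMoment ρ (fun t => t ^ h) f := by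
    rw [testMoment_eq hμ hρ hψ hfC, countMoment,
      ← lintegral_mul_const _ (measurable_of_countable _)]
    refine lintegral_mono fun n => ?_
    dsimp only
    rw [← ENNReal.mul_rpow_of_nonneg _ _ hh0, he, ← lintegral_sum_eval _ hUm n]
    refine rpow_lintegral_le _ (Measurable.aemeasurable ?_) hh.le
    exact Finset.measurable_fun_sum _ fun i _ => hUm.comp (measurable_pi_apply i)
  have hfin' : countMoment ν h * e ^ h < ∞ :=
    (hle.trans (testMoment_rpow_le ρ f hh0)).trans_lt
      (ENNReal.mul_lt_top (ENNReal.rpow_lt_top_of_nonneg hh0 enorm_ne_top) hfin)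
  refine lt_top_iff_ne_top.2 fun htop => hfin'.ne ?_
  rw [htop]
  refine ENNReal.top_mul ?_
  rw [Ne, ENNReal.rpow_eq_zero_iff_of_pos (by linarith)]
  exact he0

end necessity

/-! ### From decay to finite moments -/

section sufficiency

/-- The power `t ^ (1 + p)`, truncated so that it grows linearly beyond the level `L`. -/
noncomputable def truncPow (p : ℝ) (L t : ℝ≥0∞) : ℝ≥0∞ := t * min t L ^ p

lemma measurable_truncPow (p : ℝ) (L : ℝ≥0∞) : Measurable (truncPow p L) := by
  unfold truncPow; fun_prop

lemma truncPow_le_mul {p : ℝ} (hp : 0 ≤ p) (L t : ℝ≥0∞) : truncPow p L t ≤ L ^ p * t := by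
  rw [truncPow, mul_comm]
  gcongr
  exact min_le_right _ _

lemma truncPow_le_rpow {p : ℝ} (hp : 0 ≤ p) (L t : ℝ≥0∞) : truncPow p L t ≤ t ^ (p + 1) := by
  rw [rpow_eq_mul_rpow_sub_one t (by linarith), truncPow, add_sub_cancel_right]
  gcongr
  exact min_le_left _ _

lemma truncPow_mono {p : ℝ} (hp : 0 ≤ p) (L : ℝ≥0∞) : Monotone (truncPow p L) := by
  intro s t hst
  unfold truncPow
  gcongr

lemma monotone_truncPow_level {p : ℝ} (hp : 0 ≤ p) (t : ℝ≥0∞) :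
    Monotone fun L : ℕ => truncPow p L t := by
  intro L L' h
  simp only [truncPow]
  gcongr

lemma tendsto_truncPow {p : ℝ} (hp : 0 ≤ p) {t : ℝ≥0∞} (ht : t ≠ ∞) :
    Tendsto (fun L : ℕ => truncPow p L t) atTop (nhds (t ^ (p + 1))) := by
  obtain ⟨L₀, hL₀⟩ := ENNReal.exists_nat_gt ht
  refine tendsto_const_nhds.congr' ?_
  filter_upwards [eventually_ge_atTop L₀] with L hL
  have : t ≤ L := hL₀.le.trans (by exact_mod_cast hL)
  rw [truncPow, min_eq_left this, rpow_eq_mul_rpow_sub_one t (by linarith), add_sub_cancel_right]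

variable {V : Type*} [NormedAddCommGroup V] [MeasurableSpace V] [BorelSpace V] {ρ : Measure V}

lemma tendsto_lintegral_indicator_enorm_gt (hρ : ∫⁻ z, ‖z‖ₑ ∂ρ ≠ ∞) :
    Tendsto (fun R : ℕ => ∫⁻ z, {z : V | (R : ℝ≥0∞) < ‖z‖ₑ}.indicator (fun z => ‖z‖ₑ) z ∂ρ)
      atTop (nhds 0) := by
  rw [← lintegral_zero (μ := ρ)]
  refine tendsto_lintegral_of_dominated_convergence (fun z => ‖z‖ₑ)
    (fun R => measurable_enorm.indicator (measurableSet_lt measurable_const measurable_enorm))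
    (fun R => ae_of_all _ fun z => Set.indicator_le_self _ _ _) hρ (ae_of_all _ fun z => ?_)
  obtain ⟨R₀, hR₀⟩ := ENNReal.exists_nat_gt (enorm_ne_top (x := z))
  refine tendsto_const_nhds.congr' ?_
  filter_upwards [eventually_ge_atTop R₀] with R hR
  have : ‖z‖ₑ ≤ R := hR₀.le.trans (by exact_mod_cast hR)
  rw [Set.indicator_of_notMem]
  exact not_lt.2 this

variable [InnerProductSpace ℝ V] [IsProbabilityMeasure ρ]

/-- Splitting `Z` at the level `R`: the truncated moment is a multiple of `|l| ^ (p + 1)` plus a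
linear term whose coefficient is small for large `R`. -/
lemma testMoment_truncPow_le {p : ℝ} (hp : 0 ≤ p) (L R : ℝ≥0∞) (l : V →L[ℝ] ℝ) :
    testMoment ρ (truncPow p L) l ≤ ‖l‖ₑ ^ (p + 1) * R ^ (p + 1)
      + ‖l‖ₑ * (L ^ p * ∫⁻ z, {z : V | R < ‖z‖ₑ}.indicator (fun z => ‖z‖ₑ) z ∂ρ) := by
  have hs : MeasurableSet {z : V | R < ‖z‖ₑ} := measurableSet_lt measurable_const measurable_enorm
  have hm : Measurable fun z : V => {z : V | R < ‖z‖ₑ}.indicator (fun z => ‖z‖ₑ) z :=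
    measurable_enorm.indicator hs
  rw [← lintegral_const_mul _ hm, ← lintegral_const_mul _ (hm.const_mul _)]
  calc testMoment ρ (truncPow p L) l ≤ ∫⁻ z, (‖l‖ₑ ^ (p + 1) * R ^ (p + 1)
      + ‖l‖ₑ * (L ^ p * {z : V | R < ‖z‖ₑ}.indicator (fun z => ‖z‖ₑ) z)) ∂ρ := by
        refine lintegral_mono fun z => (truncPow_mono hp L (ofReal_apply_le l z)).trans ?_
        by_cases hz : R < ‖z‖ₑ
        · rw [Set.indicator_of_mem (show z ∈ {z : V | R < ‖z‖ₑ} from hz), mul_left_comm]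
          exact (truncPow_le_mul hp L _).trans le_add_self
        · refine (truncPow_le_rpow hp L _).trans (le_trans ?_ le_self_add)
          rw [ENNReal.mul_rpow_of_nonneg _ _ (by linarith)]
          gcongr
          exact not_lt.1 hz
    _ = _ := by
        rw [lintegral_add_left measurable_const, lintegral_const, measure_univ, mul_one]

variable [FiniteDimensional ℝ V] {C : ProperCone ℝ V} {μ : Measure (V →L[ℝ] V)}
  [IsProbabilityMeasure μ] {ν : Measure ℕ}

/-- The fixed point inequality for truncated moments. The error term comes from products of two
different summands and therefore only involves moments of order below `p + 1`. -/
lemma exists_testMoment_truncPow_le (hμ : ∀ᵐ a ∂μ, a ∈ preservers C)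
    (hρ : IsFixedPoint C ν μ ρ) {p : ℝ} (hp : 0 < p)
    (hμ1 : normMoment μ 1 ≠ ∞) (hμp : normMoment μ p ≠ ∞)
    (hν : countMoment ν (max (p + 1) 2) ≠ ∞) (hρp : ∫⁻ z, ‖z‖ₑ ^ p ∂ρ ≠ ∞) :
    ∃ B : ℝ≥0∞, B ≠ ∞ ∧ ∀ (L : ℝ≥0∞), ∀ l ∈ dualSet C, testMoment ρ (truncPow p L) l
      ≤ countMoment ν 1 * ∫⁻ a, testMoment ρ (truncPow p L) (l.comp a) ∂μ
        + B * ‖l‖ₑ ^ (p + 1) := by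
  obtain ⟨c, hc, H⟩ := exists_lintegral_trunc_sum_le (μ.prod ρ) hp
  have hρ1 : ∫⁻ z, ‖z‖ₑ ^ (1 : ℝ) ∂ρ ≠ ∞ := by
    simpa only [ENNReal.rpow_one] using hρ.integrable.2.ne
  -- Moments of `⟨l, A Z⟩` are controlled by those of `A` and `Z`.
  have hmom : ∀ q : ℝ, 0 ≤ q → ∀ l : V →L[ℝ] ℝ,
      ∫⁻ x, ENNReal.ofReal (l (x.1 x.2)) ^ q ∂(μ.prod ρ)
        ≤ ‖l‖ₑ ^ q * (normMoment μ q * ∫⁻ z, ‖z‖ₑ ^ q ∂ρ) := by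
    intro q hq l
    calc _ ≤ ∫⁻ x, ‖l‖ₑ ^ q * ‖x.1 x.2‖ₑ ^ q ∂(μ.prod ρ) := by
          refine lintegral_mono fun x => ?_
          dsimp only
          rw [← ENNReal.mul_rpow_of_nonneg _ _ hq]
          exact ENNReal.rpow_le_rpow (ofReal_apply_le l _) hq
      _ = ‖l‖ₑ ^ q * ∫⁻ x, ‖x.1 x.2‖ₑ ^ q ∂(μ.prod ρ) :=
          lintegral_const_mul' _ _ (by finiteness)
      _ ≤ _ := by gcongr; exact lintegral_prod_enorm_rpow_le μ ρ hq
  refine ⟨c * countMoment ν (max (p + 1) 2) * ((normMoment μ 1 * ∫⁻ z, ‖z‖ₑ ^ (1 : ℝ) ∂ρ) *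
    (normMoment μ p * ∫⁻ z, ‖z‖ₑ ^ p ∂ρ)), by finiteness, fun L l hl => ?_⟩
  have hψ := measurable_truncPow p L
  have hU := measurable_ofReal_apply_apply l
  rw [testMoment_eq hμ hρ hψ hl, ← lintegral_prod_eq_testMoment μ ρ hψ]
  calc _ ≤ ∫⁻ n : ℕ, ((n : ℝ≥0∞) * ∫⁻ x, truncPow p L (ENNReal.ofReal (l (x.1 x.2))) ∂(μ.prod ρ) +
        c * (n : ℝ≥0∞) ^ (max (p + 1) 2) * ((∫⁻ x, ENNReal.ofReal (l (x.1 x.2)) ∂(μ.prod ρ)) *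
          ∫⁻ x, ENNReal.ofReal (l (x.1 x.2)) ^ p ∂(μ.prod ρ))) ∂ν :=
        lintegral_mono fun n => H _ hU (fun x => ENNReal.ofReal_ne_top) L n
    _ = countMoment ν 1 * ∫⁻ x, truncPow p L (ENNReal.ofReal (l (x.1 x.2))) ∂(μ.prod ρ) +
        c * countMoment ν (max (p + 1) 2) * ((∫⁻ x, ENNReal.ofReal (l (x.1 x.2)) ∂(μ.prod ρ)) *
          ∫⁻ x, ENNReal.ofReal (l (x.1 x.2)) ^ p ∂(μ.prod ρ)) := by
        rw [lintegral_add_left (measurable_of_countable _),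
          lintegral_mul_const _ (measurable_of_countable _),
          lintegral_mul_const _ (measurable_of_countable _),
          lintegral_const_mul _ (measurable_of_countable _), countMoment, countMoment]
        simp only [ENNReal.rpow_one]
    _ ≤ _ := by
        refine add_le_add_right ?_ _
        have h1 := hmom 1 zero_le_one l
        have h2 := hmom p hp.le l
        simp only [ENNReal.rpow_one] at h1 ⊢
        calc _ ≤ c * countMoment ν (max (p + 1) 2) *
              ((‖l‖ₑ * (normMoment μ 1 * ∫⁻ z, ‖z‖ₑ ∂ρ)) *
                (‖l‖ₑ ^ p * (normMoment μ p * ∫⁻ z, ‖z‖ₑ ^ p ∂ρ))) := by gcongr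
          _ = _ := by
            rw [rpow_eq_mul_rpow_sub_one ‖l‖ₑ (show 1 ≤ p + 1 by linarith), add_sub_cancel_right]
            ring

/-- One step of the bootstrap: if `p > 0`, the moment of order `p` is finite and the products decay
at `p + 1`, then the moment of order `p + 1` is finite. -/
lemma moment_lt_top_of_geometricDecay (hμ : ∀ᵐ a ∂μ, a ∈ preservers C)
    (hρ : IsFixedPoint C ν μ ρ) (hz : ∫ z, z ∂ρ ∈ interior (C : Set V))
    {f : V →L[ℝ] ℝ} (hfC : f ∈ dualSet C) {c : ℝ} (hc : 0 < c) (hf : ∀ x ∈ C, c * ‖x‖ ≤ f x)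
    {p : ℝ} (hp : 0 < p)
    (hμ1 : normMoment μ 1 ≠ ∞) (hμp : normMoment μ p ≠ ∞)
    (hν : countMoment ν (max (p + 1) 2) ≠ ∞) (hρp : ∫⁻ z, ‖z‖ₑ ^ p ∂ρ ≠ ∞)
    (hdec : GeometricDecay μ (countMoment ν 1) (p + 1)) :
    ∫⁻ z, ‖z‖ₑ ^ (p + 1) ∂ρ < ∞ := by
  obtain ⟨B, hB, HB⟩ := exists_testMoment_truncPow_le hμ hρ hp hμ1 hμp hν hρp
  obtain ⟨K, hK, HK⟩ := exists_pow_mul_prodMoment_one_le hμ hρ hz hfC hc hf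
  obtain ⟨D, hD, r, hr, HD⟩ := hdec
  have hp1 : 0 ≤ p + 1 := by linarith
  set m := countMoment ν 1 with hm
  have hcomp : ∀ (q : ℝ), 0 ≤ q → ∀ n,
      m ^ n * ∫⁻ b, ‖f.comp b‖ₑ ^ q ∂(powLaw μ n) ≤ ‖f‖ₑ ^ q * (m ^ n * prodMoment μ q n) := by
    intro q hq n
    rw [mul_left_comm, prodMoment_eq, ← lintegral_const_mul (‖f‖ₑ ^ q) (by fun_prop)]
    refine mul_le_mul_right (lintegral_mono fun b => ?_) _
    dsimp only
    rw [← ENNReal.mul_rpow_of_nonneg _ _ hq]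
    exact ENNReal.rpow_le_rpow (enorm_comp_le f b) hq
  set T := B * (‖f‖ₑ ^ (p + 1) * (D * (1 - r)⁻¹)) with hT
  have hTt : T ≠ ∞ := by
    have : (1 - r)⁻¹ ≠ ∞ := ENNReal.inv_ne_top.2 (tsub_pos_of_lt hr).ne'
    finiteness
  -- The accumulated error terms are bounded by a geometric series.
  have hsum : ∀ n, ∑ k ∈ Finset.range n,
      m ^ k * ∫⁻ b, B * ‖f.comp b‖ₑ ^ (p + 1) ∂(powLaw μ k) ≤ T := by
    intro n
    calc _ ≤ ∑ k ∈ Finset.range n, B * (‖f‖ₑ ^ (p + 1) * (D * r ^ k)) := by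
          refine Finset.sum_le_sum fun k _ => ?_
          have hmeas : Measurable fun l : V →L[ℝ] ℝ => ‖l‖ₑ ^ (p + 1) := by fun_prop
          rw [lintegral_const_mul _ (measurable_comp_left hmeas f), mul_left_comm]
          gcongr B * ?_
          exact (hcomp _ hp1 k).trans (mul_le_mul_right (HD k) _)
      _ = B * (‖f‖ₑ ^ (p + 1) * (D * ∑ k ∈ Finset.range n, r ^ k)) := by
          simp only [Finset.mul_sum]
      _ ≤ T := by
          rw [hT, ← ENNReal.tsum_geometric]
          gcongr
          exact ENNReal.sum_le_tsum _
  have hbound : ∀ L : ℕ, testMoment ρ (truncPow p L) f ≤ T := by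
    intro L
    let τ : ℕ → ℝ≥0∞ := fun R =>
      ∫⁻ z, {z : V | (R : ℝ≥0∞) < ‖z‖ₑ}.indicator (fun z => ‖z‖ₑ) z ∂ρ
    have hτ : Tendsto τ atTop (nhds 0) :=
      tendsto_lintegral_indicator_enorm_gt hρ.integrable.2.ne
    have hRn : ∀ R n : ℕ, testMoment ρ (truncPow p L) f
        ≤ (‖f‖ₑ ^ (p + 1) * D * R ^ (p + 1) * r ^ n + ‖f‖ₑ * K * (L ^ p) * τ R) + T := by
      intro R n
      refine (le_pow_mul_lintegral_powLaw_add hμ (measurable_testMoment ρ (measurable_truncPow p L))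
        (R := fun l => B * ‖l‖ₑ ^ (p + 1)) (by fun_prop) (HB L) hfC n).trans ?_
      refine add_le_add ?_ (hsum n)
      have h1 := hcomp 1 zero_le_one n
      simp only [ENNReal.rpow_one] at h1
      have hmeas : Measurable fun l : V →L[ℝ] ℝ => ‖l‖ₑ ^ (p + 1) := by fun_prop
      calc m ^ n * ∫⁻ b, testMoment ρ (truncPow p L) (f.comp b) ∂(powLaw μ n)
          ≤ m ^ n * ∫⁻ b, (‖f.comp b‖ₑ ^ (p + 1) * (R : ℝ≥0∞) ^ (p + 1)
              + ‖f.comp b‖ₑ * (L ^ p * τ R)) ∂(powLaw μ n) := by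
            gcongr with b
            exact testMoment_truncPow_le hp.le L R _
        _ = (m ^ n * ∫⁻ b, ‖f.comp b‖ₑ ^ (p + 1) ∂(powLaw μ n)) * (R : ℝ≥0∞) ^ (p + 1)
              + (m ^ n * ∫⁻ b, ‖f.comp b‖ₑ ∂(powLaw μ n)) * (L ^ p * τ R) := by
            rw [lintegral_add_left ((measurable_comp_left hmeas f).mul_const _),
              lintegral_mul_const _ (measurable_comp_left hmeas f),
              lintegral_mul_const _ (measurable_comp_left measurable_enorm f)]
            ring
        _ ≤ (‖f‖ₑ ^ (p + 1) * (D * r ^ n)) * (R : ℝ≥0∞) ^ (p + 1)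
              + (‖f‖ₑ * K) * (L ^ p * τ R) := by
            refine add_le_add (mul_le_mul_left ?_ _) (mul_le_mul_left ?_ _)
            · exact (hcomp _ hp1 n).trans (mul_le_mul_right (HD n) _)
            · exact h1.trans (mul_le_mul_right (HK n) _)
        _ = _ := by ring
    -- First let the number of iterations tend to infinity, then the splitting level `R`.
    have hR : ∀ R : ℕ, testMoment ρ (truncPow p L) f ≤ (0 + ‖f‖ₑ * K * (L ^ p) * τ R) + T := by
      intro R
      have hfin : ‖f‖ₑ ^ (p + 1) * D * (R : ℝ≥0∞) ^ (p + 1) ≠ ∞ := by finiteness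
      have hpow : Tendsto (fun n : ℕ => ‖f‖ₑ ^ (p + 1) * D * (R : ℝ≥0∞) ^ (p + 1) * r ^ n) atTop
          (nhds 0) := by
        simpa using ENNReal.Tendsto.const_mul (ENNReal.tendsto_pow_atTop_nhds_zero_of_lt_one hr)
          (Or.inr hfin)
      exact ge_of_tendsto' ((hpow.add_const _).add_const T) (hRn R)
    have hlim : Tendsto (fun R => (0 + ‖f‖ₑ * K * ((L : ℝ≥0∞) ^ p) * τ R) + T) atTop
        (nhds ((0 + 0) + T)) := by
      refine Tendsto.add_const T (Tendsto.const_add _ ?_)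
      have hfin : ‖f‖ₑ * K * (L : ℝ≥0∞) ^ p ≠ ∞ := by finiteness
      simpa using ENNReal.Tendsto.const_mul hτ (Or.inr hfin)
    simpa using ge_of_tendsto' hlim hR
  have hfm : Measurable fun z : V => ENNReal.ofReal (f z) :=
    ENNReal.measurable_ofReal.comp f.measurable
  have hlim : Tendsto (fun L : ℕ => testMoment ρ (truncPow p L) f) atTop
      (nhds (testMoment ρ (fun t => t ^ (p + 1)) f)) :=
    lintegral_tendsto_of_tendsto_of_monotone
      (fun L => ((measurable_truncPow p L).comp hfm).aemeasurable)
      (ae_of_all _ fun z => monotone_truncPow_level hp.le _)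
      (ae_of_all _ fun z => tendsto_truncPow hp.le ENNReal.ofReal_ne_top)
  have hfT : testMoment ρ (fun t => t ^ (p + 1)) f ≤ T := le_of_tendsto' hlim hbound
  calc ∫⁻ z, ‖z‖ₑ ^ (p + 1) ∂ρ
      ≤ ∫⁻ z, ENNReal.ofReal (1 / c) ^ (p + 1) * ENNReal.ofReal (f z) ^ (p + 1) ∂ρ := by
        refine lintegral_mono_ae ?_
        filter_upwards [hρ.mem_cone] with z hz
        rw [← ENNReal.mul_rpow_of_nonneg _ _ hp1, ← ENNReal.ofReal_mul (by positivity),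
          ← ofReal_norm]
        refine ENNReal.rpow_le_rpow (ENNReal.ofReal_le_ofReal ?_) hp1
        rw [one_div_mul_eq_div, le_div_iff₀ hc, mul_comm]
        exact hf z hz
    _ = ENNReal.ofReal (1 / c) ^ (p + 1) * testMoment ρ (fun t => t ^ (p + 1)) f :=
        lintegral_const_mul _ (hfm.pow_const _)
    _ < ∞ := ENNReal.mul_lt_top (by finiteness) (hfT.trans_lt hTt.lt_top)

end sufficiency

end Cascade

theorem mainTheorem5 {V : Type*} [NormedAddCommGroup V] [InnerProductSpace ℝ V]
    [FiniteDimensional ℝ V] [MeasurableSpace V] [BorelSpace V]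
    (hd : 1 < Module.finrank ℝ V)
    (C : ProperCone ℝ V) (hC_salient : ∀ x ∈ C, -x ∈ C → x = 0)
    (hC_solid : (interior (C : Set V)).Nonempty)
    (μ : Measure (V →L[ℝ] V)) [IsProbabilityMeasure μ]
    (hμ_cone : ∀ᵐ a ∂μ, a ∈ Cascade.preservers C)
    (hμ_mean : Integrable (fun a : V →L[ℝ] V => a) μ)
    (hμ_C : Cascade.ConditionC C (Cascade.suppSemigroup μ : Set (V →L[ℝ] V)))
    (ν : Measure ℕ) [IsProbabilityMeasure ν]
    (hν_two : ∀ᵐ n ∂ν, 2 ≤ n)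
    (hν_sq : Cascade.countMoment ν 2 < ∞)
    (ρ : Measure V) [IsProbabilityMeasure ρ]
    (hρ : Cascade.IsFixedPoint C ν μ ρ)
    (h : ℝ) (hh : 1 < h) :
    ∫⁻ z, ‖z‖ₑ ^ h ∂ρ < ∞ ↔
      (h ∈ Cascade.momentInterval μ ∧ Cascade.kappa μ h < (Cascade.countMoment ν 1)⁻¹) ∧
        Cascade.countMoment ν h < ∞ := by
  have hm : Cascade.countMoment ν 1 ≠ ∞ :=
    (Cascade.lintegral_rpow_lt_top_of_le ν zero_le_one one_le_two hν_sq).ne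
  have hm0 : Cascade.countMoment ν 1 ≠ 0 := by
    have : ∫⁻ _ : ℕ, 2 ∂ν ≤ Cascade.countMoment ν 1 := by
      refine lintegral_mono_ae ?_
      filter_upwards [hν_two] with n hn
      rw [ENNReal.rpow_one]
      exact_mod_cast hn
    rw [lintegral_const, measure_univ, mul_one] at this
    exact (lt_of_lt_of_le (by norm_num) this).ne'
  have hμ1 : Cascade.normMoment μ 1 ≠ ∞ := by
    simpa only [Cascade.normMoment, ENNReal.rpow_one] using hμ_mean.2.ne
  have hz := Cascade.mean_mem_interior hC_solid hμ_cone hμ_C hm0 hρ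
  obtain ⟨f, hfC, c, hc, hf⟩ := Cascade.exists_strictly_positive C hC_salient
  have hf0 : f ≠ 0 := by
    rintro rfl
    have h1 := hf _ (Cascade.mean_mem hρ)
    have h2 : 0 < c * ‖∫ z, z ∂ρ‖ := mul_pos hc (norm_pos_iff.2 hρ.mean_ne_zero)
    rw [zero_apply] at h1
    linarith
  constructor
  · intro hfin
    have hdec := Cascade.geometricDecay_of_moment hμ_cone hμ1 hν_two hm0 hm hρ hz hfC hc hf hh hfin
    refine ⟨⟨⟨by linarith, ?_⟩, hdec.kappa_lt hm0 hm⟩,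
      Cascade.countMoment_lt_top_of_moment hμ_cone hρ hz hfC hf0 hh hfin⟩
    obtain ⟨D, hD, r, hr, H⟩ := hdec
    have h1 : Cascade.countMoment ν 1 * Cascade.normMoment μ h < ∞ := by
      have := H 1
      rw [Cascade.prodMoment_eq, Cascade.powLaw_one, pow_one, pow_one] at this
      exact this.trans_lt (ENNReal.mul_lt_top hD.lt_top (hr.trans ENNReal.one_lt_top))
    refine lt_top_iff_ne_top.2 fun htop => h1.ne ?_
    rw [htop, ENNReal.mul_top hm0]
  · rintro ⟨⟨hI, hκ⟩, hνh⟩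
    obtain ⟨K, hK, HK⟩ := Cascade.exists_pow_mul_prodMoment_one_le hμ_cone hρ hz hfC hc hf
    have hdec : Cascade.GeometricDecay μ (Cascade.countMoment ν 1) h :=
      Cascade.geometricDecay_of_kappa_lt hm0 hm
        (fun n => (Cascade.prodMoment_lt_top μ hI.1 hI.2 n).ne) hκ
    -- Induction on the integer part of the exponent `q`, which increases by one in each step.
    have hind : ∀ k : ℕ, ∀ q : ℝ, 1 < q → q ≤ h → q ≤ k + 1 → ∫⁻ z, ‖z‖ₑ ^ q ∂ρ < ∞ := by
      intro k
      induction k with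
      | zero => intro q hq1 _ hqk; norm_num at hqk; linarith
      | succ k ih =>
        intro q hq1 hqh hqk
        have hlow : ∫⁻ z, ‖z‖ₑ ^ (q - 1) ∂ρ ≠ ∞ := by
          rcases le_or_gt q 2 with h2 | h2
          · refine (Cascade.lintegral_rpow_lt_top_of_le ρ (q := 1) (by linarith)
              (by linarith) ?_).ne
            simp only [ENNReal.rpow_one]
            exact hρ.integrable.2
          · refine (ih (q - 1) (by linarith) (by linarith) ?_).ne
            push_cast at hqk
            linarith
        have hνq : Cascade.countMoment ν (max (q - 1 + 1) 2) ≠ ∞ := by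
          rcases max_choice (q - 1 + 1) 2 with h3 | h3 <;> rw [h3]
          · exact (Cascade.lintegral_rpow_lt_top_of_le ν (by linarith) (by linarith) hνh).ne
          · exact hν_sq.ne
        have := Cascade.moment_lt_top_of_geometricDecay hμ_cone hρ hz hfC hc hf
          (p := q - 1) (by linarith) hμ1
          (Cascade.lintegral_rpow_lt_top_of_le μ (by linarith) (by linarith) hI.2).ne hνq hlow
          (by rw [sub_add_cancel]; exact hdec.interpolate hK HK hq1 hqh)
        rwa [sub_add_cancel] at this
    obtain ⟨k, hk⟩ := exists_nat_ge h
    exact hind k h hh le_rfl (by linarith)
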